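/- **Setting.** Let $\beta>0$. For each $n\ge 1$ let $\mathcal V_n=\{-1,1\}^n$ and let $(\mathcal H_n(x))_{x\in\mathcal V_n}$ be independent centred Gaussian random variables of variance $n$; for all $n$ they are defined on one common probability space with law $\mathbb P$ and expectation $\mathbb E$ (the environment; the joint law across different $n$ is arbitrary). Put $\tau_n(x)=e^{-\beta\mathcal H_n(x)}$. For a fixed environment let $(J_n(k))_{k\ge 0}$ be the simple random walk on $\mathcal V_n$ (transition probabilities $p_n(x,y)=1/n$ if $x,y$ differ in exactly one coordinate, $0$ otherwise) started from the uniform distribution, let $(e_{n,i})_{i\ge 0}$ be independent exponential random variables of mean one, independent of $J_n$, both independent of the environment, and let $\mathcal P$ denote their law and $E$ the corresponding expectation, the environment being kept fixed. Given a sequence $c_n$ let $a_n$ be defined by $a_n\mathbb P(\tau_n(x)\ge c_n)=1$ and set $\gamma_n(x)=c_n^{-1}\tau_n(x)$ and, for $t\ge 0$, $$S_n(t)=c_n^{-1}\sum_{i=0}^{\lfloor a_nt\rfloor}\tau_n(J_n(i))\,e_{n,i},\qquad M_n(t)=\sum_{i=1}^{\lfloor a_nt\rfloor}\sum_{x\in\mathcal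 V_n}p_n(J_n(i-1),x)\,\gamma_n(x)\bigl(1-e^{-1/\gamma_n(x)}\bigr).$$ For $0<\varepsilon\le 1$, the sequence $c_n$ is an *intermediate time-scale* (with exponent $\varepsilon$) if $c_n\to\infty$, $\frac{\log a_n}{n\log 2}\to\varepsilon$ and $\frac{a_n}{2^n}\to 0$. Put $\alpha(\varepsilon)=\sqrt{2\varepsilon\log 2}/\beta$. **Proposition 1.8.** Let $c_n$ be an intermediate time-scale with exponent $0<\varepsilon\le1$. (i) If $\alpha(\varepsilon)=1$, then for all $T>0$ and all $\eta>0$, $$\lim_{n\to\infty}\mathcal P\Bigl(\sup_{t\in[0,T]}\Bigl|\frac{M_n(t)}{\mathbb E(E(M_n(1)))}-t\Bigr|>\eta\Bigr)=0 \quad\text{and}\quad \lim_{n\to\infty}\mathcal P\Bigl(\sup_{t\in[0,T]}\Bigl|\frac{S_n(t)}{\mathbb E(E(M_n(1)))}-t\Bigr|>\eta\Bigr)=0,$$ where both limits hold $\mathbb P$-almost surely if $\sum_n a_n/2^n<\infty$, and in $\mathbb P$-probability if $\sum_n a_n/2^n=\infty$. (ii) If $\alpha(\varepsilon)>1$, then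 for all $T>0$ and all $\eta>0$, $\mathbb P$-almost surely, $$\lim_{n\to\infty}\mathcal P\Bigl(\sup_{t\in[0,T]}\Bigl|\frac{S_n(t)}{a_ne^{n\beta^2/2}/c_n}-t\Bigr|>\eta\Bigr)=0.$$ -/

import Mathlib

open MeasureTheory ProbabilityTheory Filter Topology

namespace REM

/-- The discrete cube of dimension `n`, whose points are the sign vectors in `{-1, 1}^n`. -/
abbrev Cube (n : ℕ) : Type := Fin n → ℤˣ

/-- Points of `{-1, 1}` are measurable, hence every subset of the cube is. -/
instance instMeasurableSingletonClassIntUnits : MeasurableSingletonClass ℤˣ where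
  measurableSet_singleton u :=
    ⟨{(u : ℤ)}, measurableSet_singleton _, by ext v; simp [Units.ext_iff]⟩

/-- One-step transition probabilities of the simple random walk on the cube: `1 / n` along each edge
(two vertices are joined by an edge if they differ in exactly one coordinate), `0` otherwise. -/
noncomputable def p (n : ℕ) (x y : Cube n) : ℝ :=
  if hammingDist x y = 1 then 1 / (n : ℝ) else 0

/-- The REM Hamiltonian: for each `n ≥ 1`, a family of independent centred Gaussian variables of
variance `n` indexed by the cube. All dimensions live on one probability space, and nothing is
assumed on the joint law of the families attached to different `n`. -/
structure IsHamiltonian {Ω : Type*} [MeasurableSpace Ω] (P : Measure Ω)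
    (H : (n : ℕ) → Cube n → Ω → ℝ) : Prop where
  law : ∀ n, 1 ≤ n → ∀ x, HasLaw (H n x) (gaussianReal 0 (n : NNReal)) P
  indep : ∀ n, 1 ≤ n → iIndepFun (H n) P

/-- The jump chains `J n` and the variables `e n i` from which the clock process is made.
For each `n ≥ 1`, `J n` is the simple random walk on the cube started in the uniform distribution,
given through its finite-dimensional distributions, and `(e n i)` is a family of independent mean one
exponential variables which is independent of `J n`. -/
structure IsJumpDynamics {Ξ : Type*} [MeasurableSpace Ξ] (Q : Measure Ξ)
    (J : (n : ℕ) → ℕ → Ξ → Cube n) (e : ℕ → ℕ → Ξ → ℝ) : Prop where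
  chain_measurable : ∀ n, 1 ≤ n → ∀ i, Measurable (J n i)
  chain_law : ∀ n, 1 ≤ n → ∀ (k : ℕ) (w : ℕ → Cube n),
    Q.real {ξ | ∀ i ≤ k, J n i ξ = w i} =
      (1 / 2 ^ n) * ∏ i ∈ Finset.range k, p n (w i) (w (i + 1))
  exp_law : ∀ n, 1 ≤ n → ∀ i, HasLaw (e n i) (expMeasure 1) Q
  exp_indep : ∀ n, 1 ≤ n → iIndepFun (e n) Q
  chain_indep_exp : ∀ n, 1 ≤ n → IndepFun (fun ξ i => J n i ξ) (fun ξ i => e n i ξ) Q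

/-- The Boltzmann weight `exp (-β h)` of a site whose energy is `h`. -/
noncomputable def boltzmann (β h : ℝ) : ℝ := Real.exp (-β * h)

/-- `a` is the sequence attached to the time-scale `c`: `a_n P(τ_n(x) ≥ c_n) = 1`. -/
def IsAuxScale {Ω : Type*} [MeasurableSpace Ω] (P : Measure Ω)
    (H : (n : ℕ) → Cube n → Ω → ℝ) (β : ℝ) (a c : ℕ → ℝ) : Prop :=
  ∀ n, 1 ≤ n → ∀ x, a n * P.real {ω | c n ≤ boltzmann β (H n x ω)} = 1

/-- `c`, with attached sequence `a`, is an intermediate time-scale with exponent `ε`. -/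
structure IsIntermediateTimeScale (ε : ℝ) (a c : ℕ → ℝ) : Prop where
  pos : 0 < ε
  le_one : ε ≤ 1
  diverges : Tendsto c atTop atTop
  log_limit : Tendsto (fun n : ℕ => Real.log (a n) / (n * Real.log 2)) atTop (𝓝 ε)
  ratio_limit : Tendsto (fun n : ℕ => a n / 2 ^ n) atTop (𝓝 0)

/-- `β_c(ε) = √(2 ε log 2)`. -/
noncomputable def betaC (ε : ℝ) : ℝ := Real.sqrt (ε * (2 * Real.log 2))

/-- `α(ε) = β_c(ε) / β`. -/
noncomputable def alpha (β ε : ℝ) : ℝ := betaC ε / β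

/-- The rescaled clock process
`S_n(t) = c_n⁻¹ ∑_{i = 0}^{⌊a_n t⌋} τ_n(J_n(i)) e_{n,i}`, for a landscape `τ`, a path `J` of the jump
chain and a sequence `e`; here `a` and `c` are the values at `n` of the two scales. -/
noncomputable def clock {n : ℕ} (a c : ℝ) (τ : Cube n → ℝ) (J : ℕ → Cube n) (e : ℕ → ℝ) (t : ℝ) : ℝ :=
  c⁻¹ * ∑ i ∈ Finset.range (⌊a * t⌋₊ + 1), τ (J i) * e i

/-- The rescaled landscape `γ_n(x) = τ_n(x) / c_n`. -/
noncomputable def rescaled {n : ℕ} (c : ℝ) (τ : Cube n → ℝ) (x : Cube n) : ℝ := c⁻¹ * τ x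

/-- The centering process
`M_n(t) = ∑_{i = 1}^{⌊a_n t⌋} ∑_x p_n(J_n(i - 1), x) γ_n(x) (1 - exp (-1 / γ_n(x)))`. -/
noncomputable def centering {n : ℕ} (a c : ℝ) (τ : Cube n → ℝ) (J : ℕ → Cube n) (t : ℝ) : ℝ :=
  ∑ i ∈ Finset.Icc 1 ⌊a * t⌋₊, ∑ x : Cube n,
    p n (J (i - 1)) x * (rescaled c τ x * (1 - Real.exp (-1 / rescaled c τ x)))

/-- The random landscape `τ_n(x) = exp (-β H_n(x))` in the environment `ω`. -/
noncomputable def landscape {Ω : Type*} (H : (n : ℕ) → Cube n → Ω → ℝ) (β : ℝ)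
    (n : ℕ) (ω : Ω) (x : Cube n) : ℝ :=
  boltzmann β (H n x ω)

/-- `S_n(t)` in the environment `ω`, at the point `ξ` of the probability space of the dynamics. -/
noncomputable def S {Ω Ξ : Type*} (H : (n : ℕ) → Cube n → Ω → ℝ) (J : (n : ℕ) → ℕ → Ξ → Cube n)
    (e : ℕ → ℕ → Ξ → ℝ) (β : ℝ) (a c : ℕ → ℝ) (n : ℕ) (ω : Ω) (t : ℝ) (ξ : Ξ) : ℝ :=
  clock (a n) (c n) (landscape H β n ω) (fun i => J n i ξ) (fun i => e n i ξ) t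

/-- `M_n(t)` in the environment `ω`, at the point `ξ` of the probability space of the dynamics. -/
noncomputable def M {Ω Ξ : Type*} (H : (n : ℕ) → Cube n → Ω → ℝ) (J : (n : ℕ) → ℕ → Ξ → Cube n)
    (β : ℝ) (a c : ℕ → ℝ) (n : ℕ) (ω : Ω) (t : ℝ) (ξ : Ξ) : ℝ :=
  centering (a n) (c n) (landscape H β n ω) (fun i => J n i ξ) t

/-- The mean of `M_n(1)` over the jump chain and then over the environment (the integrands are
bounded as soon as `c n > 0`). -/
noncomputable def meanM {Ω Ξ : Type*} [MeasurableSpace Ω] [MeasurableSpace Ξ]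
    (P : Measure Ω) (Q : Measure Ξ) (H : (n : ℕ) → Cube n → Ω → ℝ)
    (J : (n : ℕ) → ℕ → Ξ → Cube n) (β : ℝ) (a c : ℕ → ℝ) (n : ℕ) : ℝ :=
  ∫ ω, ∫ ξ, M H J β a c n ω 1 ξ ∂Q ∂P

/-- The probability, under the law `Q` of the dynamics, that `Y` differs from the identity by more
than `η` in supremum norm over `[0, T]`. -/
noncomputable def deviationProb {Ξ : Type*} [MeasurableSpace Ξ] (Q : Measure Ξ)
    (Y : ℝ → Ξ → ℝ) (T η : ℝ) : ℝ :=
  Q.real {ξ | η < ⨆ t : Set.Icc (0 : ℝ) T, |Y t ξ - t|}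

end REM

namespace REM

section Walsh

variable {n : ℕ}

/-- The Walsh functions, which diagonalize the simple random walk on the cube. -/
noncomputable def walsh (s : Finset (Fin n)) (x : Cube n) : ℝ := ∏ i ∈ s, ((x i : ℤ) : ℝ)

lemma units_cast_sq (u : ℤˣ) : ((u : ℤ) : ℝ) * ((u : ℤ) : ℝ) = 1 := by
  rcases Int.units_eq_one_or u with rfl | rfl <;> simp

lemma walsh_mul_self (s : Finset (Fin n)) (x : Cube n) : walsh s x * walsh s x = 1 := by
  simp [walsh, ← Finset.prod_mul_distrib, units_cast_sq]

@[simp] lemma walsh_empty (x : Cube n) : walsh ∅ x = 1 := by simp [walsh]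

lemma card_cube : Fintype.card (Cube n) = 2 ^ n := by simp

lemma sum_finset_walsh (x y : Cube n) :
    ∑ s, walsh s x * walsh s y = if x = y then (2 : ℝ) ^ n else 0 := by
  have h : ∑ s, walsh s x * walsh s y = ∏ i, (1 + ((x i : ℤ) : ℝ) * ((y i : ℤ) : ℝ)) := by
    rw [Finset.prod_one_add, Finset.powerset_univ]
    simp [walsh, Finset.prod_mul_distrib]
  rw [h]
  split_ifs with hxy
  · subst hxy
    simp [units_cast_sq]
    norm_num
  · obtain ⟨i, hi⟩ : ∃ i, x i ≠ y i := by
      by_contra! hc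
      exact hxy (funext hc)
    refine Finset.prod_eq_zero (Finset.mem_univ i) ?_
    rcases Int.units_eq_one_or (x i) with h1 | h1 <;> rcases Int.units_eq_one_or (y i) with h2 | h2 <;>
      simp_all

lemma sum_cube_walsh (s t : Finset (Fin n)) :
    ∑ x, walsh s x * walsh t x = if s = t then (2 : ℝ) ^ n else 0 := by
  split_ifs with hst
  · subst hst
    simp [walsh_mul_self]
  · have h : ∀ x : Cube n, walsh s x * walsh t x =
        ∏ i, ((if i ∈ s then ((x i : ℤ) : ℝ) else 1) * (if i ∈ t then ((x i : ℤ) : ℝ) else 1)) := by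
      intro x
      rw [Finset.prod_mul_distrib, Finset.prod_ite_mem, Finset.prod_ite_mem, Finset.univ_inter,
        Finset.univ_inter, walsh, walsh]
    simp_rw [h]
    rw [← Fintype.prod_sum (fun (i : Fin n) (u : ℤˣ) =>
      (if i ∈ s then ((u : ℤ) : ℝ) else 1) * (if i ∈ t then ((u : ℤ) : ℝ) else 1))]
    obtain ⟨i, hi⟩ : ∃ i, ¬ (i ∈ s ↔ i ∈ t) := by
      by_contra! hc
      exact hst (Finset.ext hc)
    refine Finset.prod_eq_zero (Finset.mem_univ i) ?_
    have hu : (Finset.univ : Finset ℤˣ) = {1, -1} := rfl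
    rw [hu]
    by_cases h1 : i ∈ s <;> by_cases h2 : i ∈ t <;> simp_all

/-- The vertex obtained from `x` by changing the sign of its `i`-th coordinate. -/
def flip (i : Fin n) (x : Cube n) : Cube n := Function.update x i (-x i)

lemma neg_unit_ne (u : ℤˣ) : -u ≠ u := by
  rcases Int.units_eq_one_or u with rfl | rfl <;> decide

lemma flip_injective (x : Cube n) : Function.Injective fun i => flip i x := by
  intro i j hij
  by_contra hne
  have := congrFun hij i
  simp only [flip, Function.update_self, Function.update_of_ne hne] at this
  exact neg_unit_ne _ this

lemma hammingDist_eq_one_iff (x y : Cube n) : hammingDist x y = 1 ↔ ∃ i, y = flip i x := by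
  rw [hammingDist, Finset.card_eq_one]
  constructor
  · rintro ⟨i, hi⟩
    refine ⟨i, funext fun j => ?_⟩
    have hj := Finset.ext_iff.1 hi j
    simp only [Finset.mem_filter, Finset.mem_univ, true_and, Finset.mem_singleton] at hj
    by_cases h : j = i
    · subst h
      simp only [flip, Function.update_self]
      have : x j ≠ y j := hj.2 rfl
      rcases Int.units_eq_one_or (x j) with h1 | h1 <;>
        rcases Int.units_eq_one_or (y j) with h2 | h2 <;> simp_all
    · simp only [flip, Function.update_of_ne h]
      by_contra hne
      exact h (hj.1 fun h' => hne h'.symm)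
  · rintro ⟨i, rfl⟩
    refine ⟨i, Finset.ext fun j => ?_⟩
    simp only [Finset.mem_filter, Finset.mem_univ, true_and, Finset.mem_singleton]
    by_cases h : j = i
    · subst h
      simp [flip, (neg_unit_ne (x j)).symm]
    · simp [flip, h]

/-- The transition operator of the simple random walk. -/
noncomputable def step (h : Cube n → ℝ) (x : Cube n) : ℝ := ∑ y, p n x y * h y

lemma step_eq_sum_flip (h : Cube n → ℝ) (x : Cube n) :
    step h x = 1 / (n : ℝ) * ∑ i, h (flip i x) := by
  have him : (Finset.univ.filter fun y : Cube n => hammingDist x y = 1) =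
      Finset.univ.image fun i => flip i x := by
    ext y
    rw [Finset.mem_filter, hammingDist_eq_one_iff]
    simp [eq_comm]
  simp only [step, p, ite_mul, zero_mul]
  rw [← Finset.sum_filter, him, Finset.sum_image fun i _ j _ hij => flip_injective x hij,
    Finset.mul_sum]

lemma p_comm (x y : Cube n) : p n x y = p n y x := by
  simp [p, hammingDist_comm]

lemma p_nonneg (x y : Cube n) : 0 ≤ p n x y := by
  unfold p; split_ifs <;> positivity

lemma walsh_flip (s : Finset (Fin n)) (i : Fin n) (x : Cube n) :
    walsh s (flip i x) = (if i ∈ s then -1 else 1) * walsh s x := by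
  unfold walsh flip
  split_ifs with h
  · rw [← Finset.mul_prod_erase _ _ h, ← Finset.mul_prod_erase s _ h]
    have : ∀ j ∈ s.erase i, ((Function.update x i (-x i) j : ℤˣ) : ℤ) = (x j : ℤ) := by
      intro j hj
      rw [Function.update_of_ne (Finset.ne_of_mem_erase hj)]
    rw [Finset.prod_congr rfl fun j hj => by rw [this j hj]]
    simp
  · rw [one_mul]
    refine Finset.prod_congr rfl fun j hj => ?_
    rw [Function.update_of_ne]
    rintro rfl
    exact h hj

/-- The eigenvalue of the walk at the Walsh function indexed by `s`. -/
noncomputable def eigen (s : Finset (Fin n)) : ℝ := 1 - 2 * s.card / n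

lemma step_walsh (hn : 1 ≤ n) (s : Finset (Fin n)) (x : Cube n) :
    step (walsh s) x = eigen s * walsh s x := by
  have hn' : (n : ℝ) ≠ 0 := by positivity
  rw [step_eq_sum_flip]
  simp_rw [walsh_flip]
  rw [← Finset.sum_mul, Finset.sum_ite]
  simp only [Finset.sum_const, nsmul_eq_mul, mul_one, Finset.filter_univ_mem]
  have hc : (Finset.univ.filter fun i => i ∉ s).card = (n : ℝ) - s.card := by
    have : (Finset.univ.filter fun i => i ∉ s) = sᶜ := by ext; simp
    rw [this, Finset.card_compl, Nat.cast_sub (by simpa using Finset.card_le_univ s)]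
    simp
  rw [hc, eigen]
  field_simp
  ring

lemma card_le (s : Finset (Fin n)) : (s.card : ℝ) ≤ n := by
  exact_mod_cast (by simpa using Finset.card_le_univ s : s.card ≤ n)

lemma abs_eigen_le (s : Finset (Fin n)) : |eigen s| ≤ 1 := by
  have h2 := card_le s
  rcases Nat.eq_zero_or_pos n with rfl | hn
  · simp [eigen]
  have hn' : (0 : ℝ) < n := by positivity
  have h3 : (s.card : ℝ) / n ≤ 1 := by rwa [div_le_one hn']
  have h4 : 0 ≤ (s.card : ℝ) / n := by positivity
  rw [eigen, mul_div_assoc, abs_le]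
  constructor <;> linarith

/-- The average of a function under the uniform distribution of the cube. -/
noncomputable def avg (h : Cube n → ℝ) : ℝ := (∑ x, h x) / 2 ^ n

/-- The Walsh coefficients of a function on the cube. -/
noncomputable def coeff (h : Cube n → ℝ) (s : Finset (Fin n)) : ℝ := (∑ x, h x * walsh s x) / 2 ^ n

lemma walsh_expansion (h : Cube n → ℝ) (x : Cube n) : h x = ∑ s, coeff h s * walsh s x := by
  simp only [coeff, div_mul_eq_mul_div, Finset.sum_mul]
  rw [← Finset.sum_div, Finset.sum_comm]
  simp_rw [mul_assoc, ← Finset.mul_sum, sum_finset_walsh]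
  simp

lemma coeff_empty (h : Cube n → ℝ) : coeff h ∅ = avg h := by simp [coeff, avg]

lemma coeff_step (hn : 1 ≤ n) (h : Cube n → ℝ) (s : Finset (Fin n)) :
    coeff (step h) s = eigen s * coeff h s := by
  rw [coeff, coeff, mul_div_assoc']
  congr 1
  simp only [step, Finset.sum_mul, Finset.mul_sum]
  rw [Finset.sum_comm]
  refine Finset.sum_congr rfl fun y _ => ?_
  have := step_walsh hn s y
  rw [step] at this
  calc ∑ x, p n x y * h y * walsh s x = h y * ∑ x, p n y x * walsh s x := by
        rw [Finset.mul_sum]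
        exact Finset.sum_congr rfl fun x _ => by rw [p_comm]; ring
    _ = _ := by rw [this]; ring

lemma avg_step (hn : 1 ≤ n) (h : Cube n → ℝ) : avg (step h) = avg h := by
  rw [← coeff_empty, coeff_step hn, coeff_empty]
  simp [eigen]

lemma avg_sub_const (h : Cube n → ℝ) (m : ℝ) : avg (fun x => h x - m) = avg h - m := by
  simp [avg, sub_div]

lemma coeff_sub_const (h : Cube n → ℝ) (m : ℝ) {s : Finset (Fin n)} (hs : s ≠ ∅) :
    coeff (fun x => h x - m) s = coeff h s := by
  have h0 := sum_cube_walsh s ∅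
  simp only [walsh_empty, mul_one, if_neg hs] at h0
  simp [coeff, sub_mul, ← Finset.mul_sum, h0]

/-- The weighted sum of squared Walsh coefficients that controls the variance of the additive
functionals of the walk. The empty set does not contribute, since its weight is `n / 0 = 0`. -/
noncomputable def energy (h : Cube n → ℝ) : ℝ := ∑ s : Finset (Fin n), n / s.card * coeff h s ^ 2

lemma energy_nonneg (h : Cube n → ℝ) : 0 ≤ energy h :=
  Finset.sum_nonneg fun s _ => by positivity

lemma energy_step_le (hn : 1 ≤ n) (h : Cube n → ℝ) : energy (step h) ≤ energy h := by
  refine Finset.sum_le_sum fun s _ => ?_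
  rw [coeff_step hn, mul_pow]
  have : eigen s ^ 2 ≤ 1 := by
    rw [sq_le_one_iff_abs_le_one]; exact abs_eigen_le s
  gcongr
  exact mul_le_of_le_one_left (by positivity) this

lemma energy_sub_const (h : Cube n → ℝ) (m : ℝ) : energy (fun x => h x - m) = energy h := by
  refine Finset.sum_congr rfl fun s _ => ?_
  rcases eq_or_ne s ∅ with rfl | hs
  · simp
  · rw [coeff_sub_const h m hs]

lemma sum_div_card_le : ∑ s : Finset (Fin n), (n : ℝ) / s.card ≤ 4 * 2 ^ n := by
  have h1 : ∀ s : Finset (Fin n), (n : ℝ) / s.card ≤ 2 * ((n + 1) / (s.card + 1)) := by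
    intro s
    rcases Nat.eq_zero_or_pos s.card with h | h
    · rw [h]; simp; positivity
    · have : (1 : ℝ) ≤ s.card := by exact_mod_cast h
      rw [mul_div_assoc', div_le_div_iff₀ (by positivity) (by positivity)]
      nlinarith
  refine (Finset.sum_le_sum fun s _ => h1 s).trans ?_
  rw [← Finset.mul_sum]
  have h2 : ∑ s : Finset (Fin n), ((n : ℝ) + 1) / (s.card + 1) =
      ∑ j ∈ Finset.range (n + 1), ((n + 1).choose (j + 1) : ℝ) := by
    have := Finset.sum_powerset_apply_card (fun j : ℕ => ((n : ℝ) + 1) / (j + 1))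
      (x := (Finset.univ : Finset (Fin n)))
    rw [Finset.powerset_univ] at this
    rw [this]
    simp only [Finset.card_univ, Fintype.card_fin, nsmul_eq_mul]
    refine Finset.sum_congr rfl fun j _ => ?_
    have h3 := Nat.add_one_mul_choose_eq n j
    have h4 : ((n : ℝ) + 1) * n.choose j = (n + 1).choose (j + 1) * (j + 1) := by exact_mod_cast h3
    have : (j : ℝ) + 1 ≠ 0 := by positivity
    field_simp
    linarith
  rw [h2]
  have h5 := Nat.sum_range_choose (n + 1)
  rw [Finset.sum_range_succ'] at h5
  have h6 : (∑ j ∈ Finset.range (n + 1), ((n + 1).choose (j + 1) : ℝ)) + 1 = 2 ^ (n + 1) := by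
    exact_mod_cast h5
  rw [pow_succ] at h6
  linarith

end Walsh

section Chain

lemma integral_comp_fintype {Ξ α : Type*} [MeasurableSpace Ξ] (Q : Measure Ξ) [IsFiniteMeasure Q]
    [Fintype α] [MeasurableSpace α] [MeasurableSingletonClass α] {Y : Ξ → α} (hY : Measurable Y)
    (g : α → ℝ) : ∫ ξ, g (Y ξ) ∂Q = ∑ a, Q.real {ξ | Y ξ = a} * g a := by
  rw [← integral_map hY.aemeasurable (f := g)
      (by exact (measurable_of_countable g).aestronglyMeasurable), integral_fintype .of_finite]
  refine Finset.sum_congr rfl fun a _ => ?_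
  rw [map_measureReal_apply hY (measurableSet_singleton a), smul_eq_mul]
  rfl

lemma integrable_comp_fintype {Ξ α : Type*} [MeasurableSpace Ξ] (Q : Measure Ξ) [IsFiniteMeasure Q]
    [Finite α] [MeasurableSpace α] [MeasurableSingletonClass α] {Y : Ξ → α} (hY : Measurable Y)
    (g : α → ℝ) : Integrable (fun ξ => g (Y ξ)) Q :=
  (Integrable.of_finite (f := g) (μ := Q.map Y)).comp_measurable hY

/-- A simple random walk on the cube, started in the uniform distribution. -/
structure IsCubeWalk {Ξ : Type*} [MeasurableSpace Ξ] (Q : Measure Ξ) {n : ℕ}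
    (X : ℕ → Ξ → Cube n) : Prop where
  pos : 1 ≤ n
  measurable : ∀ i, Measurable (X i)
  law : ∀ (k : ℕ) (w : ℕ → Cube n), Q.real {ξ | ∀ i ≤ k, X i ξ = w i} =
      (1 / 2 ^ n) * ∏ i ∈ Finset.range k, p n (w i) (w (i + 1))

variable {Ξ : Type*} [MeasurableSpace Ξ] {Q : Measure Ξ} [IsProbabilityMeasure Q] {n : ℕ}
  {X : ℕ → Ξ → Cube n}

lemma IsCubeWalk.integral_mul_succ (hX : IsCubeWalk Q X) (u v : Cube n → ℝ) {i j : ℕ} (hij : i ≤ j) :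
    ∫ ξ, u (X i ξ) * v (X (j + 1) ξ) ∂Q = ∫ ξ, u (X i ξ) * step v (X j ξ) ∂Q := by
  classical
  let Φ : Ξ → Fin (j + 1) → Cube n := fun ξ l => X l ξ
  have hΦ : Measurable Φ := measurable_pi_lambda _ fun l => hX.measurable l
  have hlt : i < j + 1 := by omega
  have e1 := integral_comp_fintype Q (hΦ.prodMk (hX.measurable (j + 1)))
    (fun a => u (a.1 ⟨i, hlt⟩) * v a.2)
  have e2 := integral_comp_fintype Q hΦ (fun a => u (a ⟨i, hlt⟩) * step v (a ⟨j, by omega⟩))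
  simp only [Φ] at e1 e2
  rw [e1, e2, Fintype.sum_prod_type]
  refine Finset.sum_congr rfl fun w _ => ?_
  have key : ∀ z, Q.real {ξ | ((fun l : Fin (j + 1) => X l ξ), X (j + 1) ξ) = (w, z)} =
      Q.real {ξ | (fun l : Fin (j + 1) => X l ξ) = w} * p n (w ⟨j, by omega⟩) z := by
    intro z
    let w' : ℕ → Cube n := fun l => if h : l < j + 1 then w ⟨l, h⟩ else z
    have s1 : {ξ | ((fun l : Fin (j + 1) => X l ξ), X (j + 1) ξ) = (w, z)} =
        {ξ | ∀ l ≤ j + 1, X l ξ = w' l} := by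
      ext ξ
      simp only [Set.mem_ofPred_eq, Prod.mk.injEq, w']
      constructor
      · rintro ⟨h1, h2⟩ l hl
        split_ifs with h
        · exact congrFun h1 ⟨l, h⟩
        · rw [← h2]; congr 1; omega
      · intro h
        refine ⟨funext fun l => ?_, ?_⟩
        · have := h l (by omega)
          rwa [dif_pos l.2] at this
        · have := h (j + 1) le_rfl
          rwa [dif_neg (lt_irrefl _)] at this
    have s2 : {ξ | (fun l : Fin (j + 1) => X l ξ) = w} = {ξ | ∀ l ≤ j, X l ξ = w' l} := by
      ext ξ
      simp only [Set.mem_ofPred_eq, w']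
      constructor
      · intro h l hl
        rw [dif_pos (by omega)]
        exact congrFun h ⟨l, by omega⟩
      · intro h
        funext l
        have := h l (by omega)
        rwa [dif_pos l.2] at this
    rw [s1, s2, hX.law, hX.law, Finset.prod_range_succ]
    simp [w', mul_assoc]
  simp_rw [key, step, Finset.mul_sum]
  exact Finset.sum_congr rfl fun z _ => by ring

lemma IsCubeWalk.integral_eq_avg (hX : IsCubeWalk Q X) (v : Cube n → ℝ) (i : ℕ) :
    ∫ ξ, v (X i ξ) ∂Q = avg v := by
  induction i generalizing v with
  | zero =>
    rw [integral_comp_fintype Q (hX.measurable 0) v, avg, Finset.sum_div]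
    refine Finset.sum_congr rfl fun x _ => ?_
    have := hX.law 0 fun _ => x
    simp only [Nat.le_zero, forall_eq, Finset.range_zero, Finset.prod_empty, mul_one] at this
    rw [this]
    ring
  | succ i ih =>
    have := hX.integral_mul_succ (fun _ => 1) v (le_refl i)
    simp only [one_mul] at this
    rw [this, ih, avg_step hX.pos]

lemma IsCubeWalk.integral_walsh_add (hX : IsCubeWalk Q X) (u : Cube n → ℝ) (t : Finset (Fin n))
    (i d : ℕ) : ∫ ξ, u (X i ξ) * walsh t (X (i + d) ξ) ∂Q =
      eigen t ^ d * ∫ ξ, u (X i ξ) * walsh t (X i ξ) ∂Q := by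
  induction d with
  | zero => simp
  | succ d ih =>
    rw [← add_assoc, hX.integral_mul_succ u (walsh t) (Nat.le_add_right i d)]
    simp_rw [step_walsh hX.pos, fun ξ => mul_left_comm (u (X i ξ)) (eigen t)]
    rw [integral_const_mul, ih]
    ring

lemma IsCubeWalk.integral_walsh_mul_walsh (hX : IsCubeWalk Q X) (s t : Finset (Fin n)) (i j : ℕ) :
    ∫ ξ, walsh s (X i ξ) * walsh t (X j ξ) ∂Q =
      if s = t then eigen t ^ ((i - j) + (j - i)) else 0 := by
  have h0 : ∀ k, ∫ ξ, walsh s (X k ξ) * walsh t (X k ξ) ∂Q = if s = t then 1 else 0 := by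
    intro k
    rw [hX.integral_eq_avg (fun x => walsh s x * walsh t x), avg, sum_cube_walsh]
    split_ifs <;> simp
  rcases le_total i j with h | h
  · obtain ⟨d, rfl⟩ := Nat.exists_eq_add_of_le h
    rw [hX.integral_walsh_add, h0]
    simp
  · obtain ⟨d, rfl⟩ := Nat.exists_eq_add_of_le h
    simp_rw [mul_comm (walsh s _)]
    rw [hX.integral_walsh_add]
    simp_rw [mul_comm (walsh t _)]
    rw [h0]
    split_ifs with hst
    · subst hst; simp
    · simp

lemma sum_pow_dist_le {r : ℝ} (hr : |r| ≤ 1) (hr1 : r < 1) {L i : ℕ} (hi : i < L) :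
    ∑ j ∈ Finset.range L, r ^ ((i - j) + (j - i)) ≤ 2 / (1 - r) := by
  obtain ⟨m, rfl⟩ := Nat.exists_eq_add_of_le (Nat.succ_le_of_lt hi)
  rw [Finset.sum_range_add]
  have e1 : ∑ j ∈ Finset.range i.succ, r ^ ((i - j) + (j - i)) =
      ∑ j ∈ Finset.range (i + 1), r ^ j := by
    rw [← Finset.sum_range_reflect]
    refine Finset.sum_congr rfl fun j hj => ?_
    rw [Finset.mem_range] at hj
    congr 1; omega
  have e2 : ∑ x ∈ Finset.range m, r ^ ((i - (i.succ + x)) + (i.succ + x - i)) =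
      r * ∑ j ∈ Finset.range m, r ^ j := by
    rw [Finset.mul_sum]
    refine Finset.sum_congr rfl fun j hj => ?_
    rw [← pow_succ']
    congr 1; omega
  rw [e1, e2, le_div_iff₀ (by linarith)]
  have g1 := mul_neg_geom_sum r (i + 1)
  have g2 := mul_neg_geom_sum r m
  have : (∑ j ∈ Finset.range (i + 1), r ^ j + r * ∑ j ∈ Finset.range m, r ^ j) * (1 - r) =
      1 - r ^ (i + 1) + r * (1 - r ^ m) := by rw [← g1, ← g2]; ring
  rw [this, pow_succ']
  have p1 : |r ^ i| ≤ 1 := by rw [abs_pow]; exact pow_le_one₀ (abs_nonneg _) hr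
  have p2 : |r ^ m| ≤ 1 := by rw [abs_pow]; exact pow_le_one₀ (abs_nonneg _) hr
  have q1 : -(r * r ^ i) ≤ |r| := by
    refine (neg_le_abs _).trans ?_
    rw [abs_mul]; exact mul_le_of_le_one_right (abs_nonneg _) p1
  have q2 : -(r * r ^ m) ≤ |r| := by
    refine (neg_le_abs _).trans ?_
    rw [abs_mul]; exact mul_le_of_le_one_right (abs_nonneg _) p2
  rcases le_total 0 r with h | h
  · have : 0 ≤ r * r ^ i := by positivity
    have : 0 ≤ r * r ^ m := by positivity
    linarith
  · rw [abs_of_nonpos h] at *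
    linarith

lemma two_div_one_sub_eigen (s : Finset (Fin n)) (hs : s ≠ ∅) :
    2 / (1 - eigen s) = n / s.card := by
  have h1 : (s.card : ℝ) ≠ 0 := by simpa using hs
  have h2 : (n : ℝ) ≠ 0 := by
    have := card_le s
    have : (0 : ℝ) < s.card := by positivity
    linarith
  rw [eigen]
  field_simp
  ring

lemma eigen_lt_one (s : Finset (Fin n)) (hs : s ≠ ∅) : eigen s < 1 := by
  have h1 : (0 : ℝ) < s.card := by
    have := Finset.card_pos.2 (Finset.nonempty_iff_ne_empty.2 hs)
    exact_mod_cast this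
  have := card_le s
  have h2 : (0 : ℝ) < n := by linarith
  rw [eigen]
  have : 0 < 2 * (s.card : ℝ) / n := by positivity
  linarith

/-- The variance of an additive functional of the stationary walk. -/
lemma IsCubeWalk.integral_sq_sum_sub_avg_le (hX : IsCubeWalk Q X) (h : Cube n → ℝ) (L : ℕ) :
    ∫ ξ, (∑ i ∈ Finset.range L, (h (X i ξ) - avg h)) ^ 2 ∂Q ≤ L * energy h := by
  let c : Finset (Fin n) → ℝ := fun s => if s = ∅ then 0 else coeff h s
  have hc : ∀ x, h x - avg h = ∑ s, c s * walsh s x := by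
    intro x
    rw [walsh_expansion h x, ← coeff_empty, ← Finset.add_sum_erase _ _ (Finset.mem_univ ∅),
      ← Finset.add_sum_erase (Finset.univ) (fun s => c s * walsh s x) (Finset.mem_univ ∅)]
    simp only [walsh_empty, mul_one, c, if_true, zero_add, add_sub_cancel_left]
    refine Finset.sum_congr rfl fun s hs => ?_
    rw [if_neg (Finset.ne_of_mem_erase hs)]
  have hsq : ∀ ξ, (∑ i ∈ Finset.range L, (h (X i ξ) - avg h)) ^ 2 =
      ∑ i ∈ Finset.range L, ∑ j ∈ Finset.range L, ∑ s, ∑ t,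
        c s * c t * (walsh s (X i ξ) * walsh t (X j ξ)) := by
    intro ξ
    simp_rw [hc]
    rw [sq, Finset.sum_mul_sum]
    refine Finset.sum_congr rfl fun i _ => Finset.sum_congr rfl fun j _ => ?_
    rw [Finset.sum_mul_sum]
    exact Finset.sum_congr rfl fun s _ => Finset.sum_congr rfl fun t _ => by ring
  have hint : ∀ i j s t, Integrable (fun ξ => c s * c t * (walsh s (X i ξ) * walsh t (X j ξ))) Q :=
    fun i j s t => integrable_comp_fintype Q ((hX.measurable i).prodMk (hX.measurable j))
      fun a => c s * c t * (walsh s a.1 * walsh t a.2)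
  have hval : ∫ ξ, (∑ i ∈ Finset.range L, (h (X i ξ) - avg h)) ^ 2 ∂Q =
      ∑ i ∈ Finset.range L, ∑ s, c s ^ 2 *
        ∑ j ∈ Finset.range L, eigen s ^ ((i - j) + (j - i)) := by
    simp_rw [hsq]
    rw [integral_finsetSum _ fun i _ => integrable_finsetSum _ fun j _ =>
      integrable_finsetSum _ fun s _ => integrable_finsetSum _ fun t _ => hint i j s t]
    refine Finset.sum_congr rfl fun i _ => ?_
    rw [integral_finsetSum _ fun j _ =>
      integrable_finsetSum _ fun s _ => integrable_finsetSum _ fun t _ => hint i j s t]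
    simp_rw [Finset.mul_sum]
    rw [Finset.sum_comm]
    refine Finset.sum_congr rfl fun j _ => ?_
    rw [integral_finsetSum _ fun s _ => integrable_finsetSum _ fun t _ => hint i j s t]
    refine Finset.sum_congr rfl fun s _ => ?_
    rw [integral_finsetSum _ fun t _ => hint i j s t]
    simp_rw [integral_const_mul, hX.integral_walsh_mul_walsh]
    simp [sq]
  rw [hval]
  calc _ ≤ ∑ i ∈ Finset.range L, energy h := by
        refine Finset.sum_le_sum fun i hi => Finset.sum_le_sum fun s _ => ?_
        rcases eq_or_ne s ∅ with rfl | hs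
        · simp [c]
        · simp only [c, if_neg hs]
          rw [mul_comm, ← two_div_one_sub_eigen s hs]
          gcongr
          exact sum_pow_dist_le (abs_eigen_le s) (eigen_lt_one s hs) (Finset.mem_range.1 hi)
    _ = L * energy h := by simp

end Chain

section Truncation

instance : IsProbabilityMeasure (expMeasure 1) := isProbabilityMeasure_expMeasure one_pos

instance : NullSingletonClass (expMeasure 1) := by
  unfold expMeasure gammaMeasure
  infer_instance

lemma expMeasure_one_real_Ici {u : ℝ} (hu : 0 ≤ u) :
    (expMeasure 1).real (Set.Ici u) = Real.exp (-u) := by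
  rw [← measureReal_congr (μ := expMeasure 1) Ioi_ae_eq_Ici, ← Set.compl_Iic,
    probReal_compl_eq_one_sub measurableSet_Iic, ← cdf_eq_real, cdf_expMeasure_eq one_pos]
  simp [hu]

lemma expMeasure_one_Iio : expMeasure 1 (Set.Iio 0) = 0 := by
  have h : (expMeasure 1).real (Set.Iio 0) = 0 := by
    rw [← Set.compl_Ici, probReal_compl_eq_one_sub measurableSet_Ici,
      expMeasure_one_real_Ici le_rfl]
    simp
  rwa [measureReal_eq_zero_iff] at h

/-- The contribution `z * s` of one visit to the clock, truncated to the interval `[0, A]`. -/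
noncomputable def cut (A z s : ℝ) : ℝ := max 0 (min (z * s) A)

/-- The mean of `cut A z` under the exponential distribution. -/
noncomputable def cutMean (A z : ℝ) : ℝ := z * (1 - Real.exp (-A / z))

/-- The probability that `cut A z` differs from `z * s` under the exponential distribution. -/
noncomputable def overshoot (A z : ℝ) : ℝ := Real.exp (-A / z)

lemma cut_nonneg (A z s : ℝ) : 0 ≤ cut A z s := le_max_left _ _

lemma cut_le {A : ℝ} (hA : 0 ≤ A) (z s : ℝ) : cut A z s ≤ A := max_le hA (min_le_right _ _)

lemma measurable_cut (A z : ℝ) : Measurable (cut A z) := by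
  unfold cut; fun_prop

lemma integrable_cut {A : ℝ} (hA : 0 ≤ A) (z : ℝ) : Integrable (cut A z) (expMeasure 1) :=
  Integrable.of_bound (measurable_cut A z).aestronglyMeasurable A
    (ae_of_all _ fun s => by
      rw [Real.norm_eq_abs, abs_of_nonneg (cut_nonneg A z s)]; exact cut_le hA z s)

lemma integral_cut {A z : ℝ} (hA : 0 ≤ A) (hz : 0 < z) :
    ∫ s, cut A z s ∂(expMeasure 1) = cutMean A z := by
  rw [(integrable_cut hA z).integral_eq_integral_Ioc_meas_le (M := A)
    (ae_of_all _ fun s => cut_nonneg A z s) (ae_of_all _ fun s => cut_le hA z s)]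
  have h1 : ∀ t ∈ Set.Ioc 0 A, (expMeasure 1).real {s | t ≤ cut A z s} = Real.exp (-t / z) := by
    intro t ht
    have : {s | t ≤ cut A z s} = Set.Ici (t / z) := by
      ext s
      simp only [Set.mem_ofPred_eq, cut, le_max_iff, le_min_iff, ht.2, and_true, Set.mem_Ici,
        div_le_iff₀ hz, mul_comm s z, or_iff_right (not_le.2 ht.1)]
    rw [this, expMeasure_one_real_Ici (div_nonneg ht.1.le hz.le), neg_div]
  rw [setIntegral_congr_fun measurableSet_Ioc h1, ← intervalIntegral.integral_of_le hA]
  have hd : ∀ t : ℝ, HasDerivAt (fun t => -z * Real.exp (-t / z)) (Real.exp (-t / z)) t := by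
    intro t
    have := (((hasDerivAt_id t).neg.div_const z).exp).const_mul (-z)
    refine this.congr_deriv ?_
    simp only [Pi.neg_apply, id_eq]
    field_simp
  rw [intervalIntegral.integral_eq_sub_of_hasDerivAt (fun t _ => hd t)
    (by apply Continuous.intervalIntegrable; fun_prop)]
  simp [cutMean]; ring

lemma cutMean_nonneg {A z : ℝ} (hA : 0 ≤ A) (hz : 0 < z) : 0 ≤ cutMean A z := by
  rw [← integral_cut hA hz]
  exact integral_nonneg fun s => cut_nonneg A z s

lemma cutMean_le {A z : ℝ} (hA : 0 ≤ A) (hz : 0 < z) : cutMean A z ≤ A := by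
  rw [← integral_cut hA hz]
  calc _ ≤ ∫ _, A ∂(expMeasure 1) :=
        integral_mono (integrable_cut hA z) (integrable_const _) fun s => cut_le hA z s
    _ = A := by simp

lemma integral_sq_cut_sub_le {A z : ℝ} (hA : 0 ≤ A) (hz : 0 < z) :
    ∫ s, (cut A z s - cutMean A z) ^ 2 ∂(expMeasure 1) ≤ A * cutMean A z := by
  have i1 := integrable_cut hA z
  have i2 : Integrable (fun s => cut A z s ^ 2) (expMeasure 1) :=
    Integrable.of_bound ((measurable_cut A z).pow_const 2).aestronglyMeasurable (A ^ 2)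
      (ae_of_all _ fun s => by
        rw [Real.norm_eq_abs, abs_of_nonneg (by positivity)]
        have := cut_nonneg A z s
        have := cut_le hA z s
        gcongr)
  have h1 : ∫ s, (cut A z s - cutMean A z) ^ 2 ∂(expMeasure 1) =
      ∫ s, cut A z s ^ 2 ∂(expMeasure 1) - cutMean A z ^ 2 := by
    have : ∀ s, (cut A z s - cutMean A z) ^ 2 =
        (cut A z s ^ 2 - 2 * cutMean A z * cut A z s) + cutMean A z ^ 2 := fun s => by ring
    simp_rw [this]
    rw [integral_add (f := fun s => cut A z s ^ 2 - 2 * cutMean A z * cut A z s)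
      (i2.sub (i1.const_mul _)) (integrable_const _), integral_sub i2 (i1.const_mul _),
      integral_const_mul, integral_cut hA hz]
    simp; ring
  have h2 : ∫ s, cut A z s ^ 2 ∂(expMeasure 1) ≤ A * cutMean A z := by
    rw [← integral_cut hA hz, ← integral_const_mul]
    refine integral_mono i2 (i1.const_mul _) fun s => ?_
    have := cut_nonneg A z s
    have := cut_le hA z s
    simp only [sq]
    gcongr
  nlinarith [sq_nonneg (cutMean A z)]

lemma expMeasure_cut_ne_le {A z : ℝ} (hA : 0 ≤ A) (hz : 0 < z) :
    (expMeasure 1).real {s | z * s ≠ cut A z s} ≤ overshoot A z := by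
  have h : {s | z * s ≠ cut A z s} ⊆ Set.Iio 0 ∪ Set.Ici (A / z) := by
    intro s hs
    by_contra hc
    simp only [Set.mem_union, Set.mem_Iio, Set.mem_Ici, not_or, not_lt, not_le,
      lt_div_iff₀ hz] at hc
    refine hs ?_
    rw [cut, min_eq_left (by linarith [mul_comm s z]), max_eq_right (mul_nonneg hz.le hc.1)]
  refine (measureReal_mono h).trans ((measureReal_union_le _ _).trans ?_)
  rw [expMeasure_one_real_Ici (by positivity), measureReal_def, expMeasure_one_Iio, overshoot,
    neg_div]
  simp

end Truncation

section Clock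

lemma integral_indep_fintype {Ξ α γ : Type*} [MeasurableSpace Ξ] {Q : Measure Ξ}
    [IsProbabilityMeasure Q] [Fintype α] [MeasurableSpace α] [MeasurableSingletonClass α]
    [MeasurableSpace γ] {U : Ξ → α} {V : Ξ → γ} (hU : Measurable U) (hUV : IndepFun U V Q)
    (hV : AEMeasurable V Q) {g : α → γ → ℝ} (hg : ∀ a, Measurable (g a))
    (hi : ∀ a, Integrable (fun ξ => g a (V ξ)) Q) :
    Integrable (fun ξ => g (U ξ) (V ξ)) Q ∧
    ∫ ξ, g (U ξ) (V ξ) ∂Q = ∑ a, Q.real {ξ | U ξ = a} * ∫ ξ, g a (V ξ) ∂Q := by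
  classical
  have h1 : (fun ξ => g (U ξ) (V ξ)) =
      fun ξ => ∑ a, (if U ξ = a then (1 : ℝ) else 0) * g a (V ξ) := by
    ext ξ; simp
  have hm : ∀ a, Measurable fun u : α => if u = a then (1 : ℝ) else 0 :=
    fun a => measurable_of_countable _
  have hint : ∀ a, Integrable (fun ξ => (if U ξ = a then (1 : ℝ) else 0) * g a (V ξ)) Q := by
    intro a
    refine (hi a).bdd_mul (c := 1) ((hm a).comp hU).aestronglyMeasurable (ae_of_all _ fun ξ => ?_)
    split_ifs <;> simp
  rw [h1]
  refine ⟨integrable_finsetSum _ fun a _ => hint a, ?_⟩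
  rw [integral_finsetSum _ fun a _ => hint a]
  refine Finset.sum_congr rfl fun a _ => ?_
  have hind : IndepFun (fun ξ => if U ξ = a then (1 : ℝ) else 0) (fun ξ => g a (V ξ)) Q :=
    hUV.comp (hm a) (hg a)
  rw [hind.integral_fun_mul_eq_mul_integral ((hm a).comp hU).aestronglyMeasurable
    ((hg a).comp_aemeasurable hV).aestronglyMeasurable,
    integral_comp_fintype Q hU fun u => if u = a then (1 : ℝ) else 0]
  simp

/-- A simple random walk on the cube together with independent exponential waiting times. -/
structure IsTimedWalk {Ξ : Type*} [MeasurableSpace Ξ] (Q : Measure Ξ) {n : ℕ}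
    (X : ℕ → Ξ → Cube n) (E : ℕ → Ξ → ℝ) : Prop where
  walk : IsCubeWalk Q X
  exp_law : ∀ i, HasLaw (E i) (expMeasure 1) Q
  exp_indep : iIndepFun E Q
  indep : IndepFun (fun ξ i => X i ξ) (fun ξ i => E i ξ) Q

variable {Ξ : Type*} [MeasurableSpace Ξ] {Q : Measure Ξ} {n : ℕ} {X : ℕ → Ξ → Cube n}
  {E : ℕ → Ξ → ℝ}

lemma IsTimedWalk.indepFun_single (hX : IsTimedWalk Q X E) (i : ℕ) : IndepFun (X i) (E i) Q :=
  hX.indep.comp (φ := fun f : ℕ → Cube n => f i) (ψ := fun f : ℕ → ℝ => f i) (measurable_pi_apply i)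
    (measurable_pi_apply i)

lemma IsTimedWalk.indepFun_pair (hX : IsTimedWalk Q X E) (i j : ℕ) :
    IndepFun (fun ξ => (X i ξ, X j ξ)) (fun ξ => (E i ξ, E j ξ)) Q :=
  hX.indep.comp (φ := fun f : ℕ → Cube n => (f i, f j)) (ψ := fun f : ℕ → ℝ => (f i, f j))
    ((measurable_pi_apply i).prodMk (measurable_pi_apply j))
    ((measurable_pi_apply i).prodMk (measurable_pi_apply j))

variable [IsProbabilityMeasure Q]

lemma abs_cut_sub_le {A z : ℝ} (hA : 0 ≤ A) (hz : 0 < z) (s : ℝ) :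
    |cut A z s - cutMean A z| ≤ A := by
  rw [abs_le]
  constructor <;>
    linarith [cut_nonneg A z s, cut_le hA z s, cutMean_nonneg hA hz, cutMean_le hA hz]

lemma IsTimedWalk.integral_sq_sum_cut_sub_le (hX : IsTimedWalk Q X E) {A : ℝ} (hA : 0 ≤ A)
    {z : Cube n → ℝ} (hz : ∀ x, 0 < z x) (L : ℕ) :
    ∫ ξ, (∑ i ∈ Finset.range L, (cut A (z (X i ξ)) (E i ξ) - cutMean A (z (X i ξ)))) ^ 2 ∂Q ≤
      L * (A * avg fun x => cutMean A (z x)) := by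
  let k : Cube n → ℝ → ℝ := fun x s => cut A (z x) s - cutMean A (z x)
  have hk : ∀ x, Measurable (k x) := fun x => (measurable_cut A (z x)).sub_const _
  have hkA : ∀ x s, ‖k x s‖ ≤ A := fun x s => abs_cut_sub_le hA (hz x) s
  have hki : ∀ x i, Integrable (fun ξ => k x (E i ξ)) Q := fun x i =>
    Integrable.of_bound ((hk x).comp_aemeasurable (hX.exp_law i).aemeasurable).aestronglyMeasurable
      A (ae_of_all _ fun ξ => hkA _ _)
  have hk0 : ∀ x i, ∫ ξ, k x (E i ξ) ∂Q = 0 := by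
    intro x i
    have := (hX.exp_law i).integral_comp (f := k x) (hk x).aestronglyMeasurable
    simp only [Function.comp_def] at this
    rw [this]
    simp only [k]
    rw [integral_sub (integrable_cut hA _) (integrable_const _), integral_cut hA (hz x)]
    simp
  have hpair : ∀ i j, Integrable (fun ξ => k (X i ξ) (E i ξ) * k (X j ξ) (E j ξ)) Q ∧
      ∫ ξ, k (X i ξ) (E i ξ) * k (X j ξ) (E j ξ) ∂Q = ∑ a : Cube n × Cube n,
        Q.real {ξ | (X i ξ, X j ξ) = a} * ∫ ξ, k a.1 (E i ξ) * k a.2 (E j ξ) ∂Q := by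
    intro i j
    refine integral_indep_fintype (g := fun a s => k a.1 s.1 * k a.2 s.2)
      ((hX.walk.measurable i).prodMk (hX.walk.measurable j)) (hX.indepFun_pair i j)
      ((hX.exp_law i).aemeasurable.prodMk (hX.exp_law j).aemeasurable)
      (fun a => ((hk _).comp measurable_fst).mul ((hk _).comp measurable_snd)) (fun a => ?_)
    refine (hki a.2 j).bdd_mul (c := A) (hki a.1 i).aestronglyMeasurable
      (ae_of_all _ fun ξ => hkA _ _)
  have hoff : ∀ i j, i ≠ j → ∫ ξ, k (X i ξ) (E i ξ) * k (X j ξ) (E j ξ) ∂Q = 0 := by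
    intro i j hij
    rw [(hpair i j).2]
    refine Finset.sum_eq_zero fun a _ => ?_
    have hind : IndepFun (fun ξ => k a.1 (E i ξ)) (fun ξ => k a.2 (E j ξ)) Q :=
      (hX.exp_indep.indepFun hij).comp (hk _) (hk _)
    rw [hind.integral_fun_mul_eq_mul_integral (hki _ _).aestronglyMeasurable
      (hki _ _).aestronglyMeasurable, hk0]
    simp
  have hdiag : ∀ i, ∫ ξ, k (X i ξ) (E i ξ) * k (X i ξ) (E i ξ) ∂Q ≤
      A * avg fun x => cutMean A (z x) := by
    intro i
    rw [(integral_indep_fintype (g := fun x s => k x s * k x s) (hX.walk.measurable i)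
      (hX.indepFun_single i) (hX.exp_law i).aemeasurable (fun x => (hk x).mul (hk x))
      (fun x => (hki x i).bdd_mul (c := A) (hki x i).aestronglyMeasurable
        (ae_of_all _ fun ξ => hkA _ _))).2, ← hX.walk.integral_eq_avg _ i, ← integral_const_mul,
      integral_comp_fintype Q (hX.walk.measurable i) fun x => A * cutMean A (z x)]
    refine Finset.sum_le_sum fun x _ => mul_le_mul_of_nonneg_left ?_ measureReal_nonneg
    have := (hX.exp_law i).integral_comp (f := fun s => k x s * k x s)
      ((hk x).mul (hk x)).aestronglyMeasurable
    simp only [Function.comp_def] at this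
    rw [this]
    simpa only [k, sq] using integral_sq_cut_sub_le hA (hz x)
  have hsq : ∀ ξ, (∑ i ∈ Finset.range L, (cut A (z (X i ξ)) (E i ξ) - cutMean A (z (X i ξ)))) ^ 2 =
      ∑ i ∈ Finset.range L, ∑ j ∈ Finset.range L, k (X i ξ) (E i ξ) * k (X j ξ) (E j ξ) := by
    intro ξ
    rw [sq, Finset.sum_mul_sum]
  simp_rw [hsq]
  rw [integral_finsetSum _ fun i _ => integrable_finsetSum _ fun j _ => (hpair i j).1]
  calc _ ≤ ∑ i ∈ Finset.range L, A * avg fun x => cutMean A (z x) := by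
        refine Finset.sum_le_sum fun i hi => ?_
        rw [integral_finsetSum _ fun j _ => (hpair i j).1,
          Finset.sum_eq_single_of_mem i hi fun j _ hji => hoff i j hji.symm]
        exact hdiag i
    _ = _ := by simp

/-- Chebyshev's inequality for the additive functionals of the walk. -/
lemma IsCubeWalk.measureReal_sum_le (hX : IsCubeWalk Q X) (h : Cube n → ℝ) (L : ℕ) {r : ℝ}
    (hr : 0 < r) :
    Q.real {ξ | r ≤ |∑ i ∈ Finset.range L, h (X i ξ) - L * avg h|} ≤ L * energy h / r ^ 2 := by
  have hi : Integrable (fun ξ => (∑ i ∈ Finset.range L, (h (X i ξ) - avg h)) ^ 2) Q := by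
    have := integrable_comp_fintype Q (Y := fun ξ (i : Fin L) => X i ξ)
      (measurable_pi_lambda _ fun i => hX.measurable i)
      fun a => (∑ i : Fin L, (h (a i) - avg h)) ^ 2
    simpa only [Finset.sum_range] using this
  have hm := mul_meas_ge_le_integral_of_nonneg (ae_of_all Q fun ξ => sq_nonneg _) hi (r ^ 2)
  rw [le_div_iff₀ (by positivity), mul_comm]
  refine le_trans ?_ (hm.trans (hX.integral_sq_sum_sub_avg_le h L))
  refine mul_le_mul_of_nonneg_left (measureReal_mono ?_) (by positivity)
  intro ξ hξ
  simp only [Set.mem_ofPred_eq] at hξ ⊢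
  rw [Finset.sum_sub_distrib, Finset.sum_const, Finset.card_range, nsmul_eq_mul, ← sq_abs (_ - _)]
  gcongr

/-- Chebyshev's inequality for the truncated clock. -/
lemma IsTimedWalk.measureReal_sum_cut_le (hX : IsTimedWalk Q X E) {A : ℝ} (hA : 0 ≤ A)
    {z : Cube n → ℝ} (hz : ∀ x, 0 < z x) (L : ℕ) {r : ℝ} (hr : 0 < r) :
    Q.real {ξ | r ≤ |∑ i ∈ Finset.range L, cut A (z (X i ξ)) (E i ξ) -
      L * avg fun x => cutMean A (z x)|} ≤
      4 * L * (energy (fun x => cutMean A (z x)) + A * avg fun x => cutMean A (z x)) / r ^ 2 := by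
  set h : Cube n → ℝ := fun x => cutMean A (z x) with hh
  have hm1 := hX.walk.measureReal_sum_le h L (half_pos hr)
  have hXE : ∀ i, AEStronglyMeasurable (fun ξ => cut A (z (X i ξ)) (E i ξ) - h (X i ξ)) Q := by
    intro i
    have := (integral_indep_fintype (Q := Q) (g := fun x s => cut A (z x) s - h x)
      (hX.walk.measurable i) (hX.indepFun_single i) (hX.exp_law i).aemeasurable
      (fun x => (measurable_cut A (z x)).sub_const _) fun x => ?_).1.aestronglyMeasurable
    · exact this
    · exact Integrable.of_bound (((measurable_cut A (z x)).sub_const _).comp_aemeasurable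
        (hX.exp_law i).aemeasurable).aestronglyMeasurable A
        (ae_of_all _ fun ξ => abs_cut_sub_le hA (hz x) _)
  have hi : Integrable (fun ξ => (∑ i ∈ Finset.range L,
      (cut A (z (X i ξ)) (E i ξ) - h (X i ξ))) ^ 2) Q := by
    refine Integrable.of_bound
      ((Finset.aestronglyMeasurable_fun_sum _ fun i _ => hXE i).pow 2) ((L * A) ^ 2)
      (ae_of_all _ fun ξ => ?_)
    rw [norm_pow, Real.norm_eq_abs]
    gcongr
    refine (Finset.abs_sum_le_sum_abs _ _).trans ?_
    calc _ ≤ ∑ i ∈ Finset.range L, A :=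
          Finset.sum_le_sum fun i _ => abs_cut_sub_le hA (hz _) _
      _ = L * A := by simp
  have hm2 : Q.real {ξ | r / 2 ≤ |∑ i ∈ Finset.range L,
      (cut A (z (X i ξ)) (E i ξ) - h (X i ξ))|} ≤ L * (A * avg h) / (r / 2) ^ 2 := by
    have hm := mul_meas_ge_le_integral_of_nonneg (ae_of_all Q fun ξ => sq_nonneg _) hi ((r / 2) ^ 2)
    rw [le_div_iff₀ (by positivity), mul_comm]
    refine le_trans ?_ (hm.trans (hX.integral_sq_sum_cut_sub_le hA hz L))
    refine mul_le_mul_of_nonneg_left (measureReal_mono ?_) (by positivity)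
    intro ξ hξ
    simp only [Set.mem_ofPred_eq] at hξ ⊢
    rw [← sq_abs (∑ i ∈ Finset.range L, _)]
    gcongr
  have hsub : {ξ | r ≤ |∑ i ∈ Finset.range L, cut A (z (X i ξ)) (E i ξ) - L * avg h|} ⊆
      {ξ | r / 2 ≤ |∑ i ∈ Finset.range L, h (X i ξ) - L * avg h|} ∪
      {ξ | r / 2 ≤ |∑ i ∈ Finset.range L, (cut A (z (X i ξ)) (E i ξ) - h (X i ξ))|} := by
    intro ξ hξ
    by_contra hc
    simp only [Set.mem_union, Set.mem_ofPred_eq, not_or, not_le, Finset.sum_sub_distrib] at hc hξ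
    have e : ∑ i ∈ Finset.range L, cut A (z (X i ξ)) (E i ξ) - L * avg h =
      (∑ i ∈ Finset.range L, h (X i ξ) - L * avg h) +
      (∑ i ∈ Finset.range L, cut A (z (X i ξ)) (E i ξ) - ∑ i ∈ Finset.range L, h (X i ξ)) := by ring
    have := abs_add_le (∑ i ∈ Finset.range L, h (X i ξ) - L * avg h)
      (∑ i ∈ Finset.range L, cut A (z (X i ξ)) (E i ξ) - ∑ i ∈ Finset.range L, h (X i ξ))
    rw [← e] at this
    linarith
  refine (measureReal_mono hsub).trans ((measureReal_union_le _ _).trans ?_)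
  refine (add_le_add hm1 hm2).trans (le_of_eq ?_)
  field_simp
  ring

/-- The truncation is not seen by the first `L` visits, up to the mean overshoot. -/
lemma IsTimedWalk.measureReal_exists_cut_ne_le (hX : IsTimedWalk Q X E) {A : ℝ} (hA : 0 ≤ A)
    {z : Cube n → ℝ} (hz : ∀ x, 0 < z x) (L : ℕ) :
    Q.real {ξ | ∃ i < L, z (X i ξ) * E i ξ ≠ cut A (z (X i ξ)) (E i ξ)} ≤
      L * avg fun x => overshoot A (z x) := by
  have h1 : ∀ i, Q.real {ξ | z (X i ξ) * E i ξ ≠ cut A (z (X i ξ)) (E i ξ)} ≤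
      avg fun x => overshoot A (z x) := by
    intro i
    let D : Cube n → Set ℝ := fun x => {s | z x * s ≠ cut A (z x) s}
    have hD : ∀ x, MeasurableSet (D x) := fun x =>
      (measurableSet_eq_fun (measurable_id.const_mul (z x)) (measurable_cut A (z x))).compl
    have hsub : {ξ | z (X i ξ) * E i ξ ≠ cut A (z (X i ξ)) (E i ξ)} =
        ⋃ x, ({ξ | X i ξ = x} ∩ {ξ | E i ξ ∈ D x}) := by
      ext ξ
      simp [D]
    have hind : ∀ x, Q.real ({ξ | X i ξ = x} ∩ {ξ | E i ξ ∈ D x}) ≤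
        Q.real {ξ | X i ξ = x} * overshoot A (z x) := by
      intro x
      have := (hX.indepFun_single i).measure_inter_preimage_eq_mul {x} (D x)
        (measurableSet_singleton x) (hD x)
      have e : Q.real ({ξ | X i ξ = x} ∩ {ξ | E i ξ ∈ D x}) =
          Q.real {ξ | X i ξ = x} * Q.real {ξ | E i ξ ∈ D x} := by
        simp only [measureReal_def, ← ENNReal.toReal_mul]
        exact congrArg _ this
      rw [e, (hX.exp_law i).measureReal_eq (p := fun s => s ∈ D x) (hD x)]
      gcongr
      exact expMeasure_cut_ne_le hA (hz x)
    rw [hsub, ← hX.walk.integral_eq_avg _ i,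
      integral_comp_fintype Q (hX.walk.measurable i) fun x => overshoot A (z x)]
    exact (measureReal_iUnion_fintype_le _).trans (Finset.sum_le_sum fun x _ => hind x)
  have hsub : {ξ | ∃ i < L, z (X i ξ) * E i ξ ≠ cut A (z (X i ξ)) (E i ξ)} ⊆
      ⋃ i ∈ Finset.range L, {ξ | z (X i ξ) * E i ξ ≠ cut A (z (X i ξ)) (E i ξ)} := by
    rintro ξ ⟨i, hi, h⟩
    exact Set.mem_biUnion (Finset.mem_coe.2 (Finset.mem_range.2 hi)) h
  refine (measureReal_mono hsub (measure_ne_top _ _)).trans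
    ((measureReal_biUnion_finset_le _ _).trans ?_)
  calc _ ≤ ∑ i ∈ Finset.range L, avg fun x => overshoot A (z x) := Finset.sum_le_sum fun i _ => h1 i
    _ = _ := by simp

end Clock

section Field

/-- Independent random variables with values in `[0, A]` and common mean `m`, attached to the
vertices of the cube. -/
structure IsBoundedField {Ω : Type*} [MeasurableSpace Ω] (P : Measure Ω) {n : ℕ}
    (h : Cube n → Ω → ℝ) (A m : ℝ) : Prop where
  aemeasurable : ∀ x, AEMeasurable (h x) P
  indep : iIndepFun h P
  nonneg : ∀ x ω, 0 ≤ h x ω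
  le : ∀ x ω, h x ω ≤ A
  mean : ∀ x, ∫ ω, h x ω ∂P = m

variable {Ω : Type*} [MeasurableSpace Ω] {P : Measure Ω} {n : ℕ}
  {h : Cube n → Ω → ℝ} {A m : ℝ}

lemma IsBoundedField.mean_nonneg (hh : IsBoundedField P h A m) : 0 ≤ m := by
  rw [← hh.mean fun _ => 1]
  exact integral_nonneg fun ω => hh.nonneg _ ω

lemma IsBoundedField.aestronglyMeasurable_sub (hh : IsBoundedField P h A m) (x : Cube n) :
    AEStronglyMeasurable (fun ω => h x ω - m) P :=
  ((hh.aemeasurable x).sub_const m).aestronglyMeasurable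

lemma IsBoundedField.indepFun_sub (hh : IsBoundedField P h A m) {x y : Cube n} (hxy : x ≠ y) :
    IndepFun (fun ω => h x ω - m) (fun ω => h y ω - m) P :=
  (hh.indep.indepFun hxy).comp (measurable_id.sub_const m) (measurable_id.sub_const m)

variable [IsProbabilityMeasure P]

lemma IsBoundedField.integrable (hh : IsBoundedField P h A m) (x : Cube n) :
    Integrable (h x) P :=
  Integrable.of_bound (hh.aemeasurable x).aestronglyMeasurable A (ae_of_all _ fun ω => by
    rw [Real.norm_eq_abs, abs_of_nonneg (hh.nonneg x ω)]; exact hh.le x ω)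

lemma IsBoundedField.mean_le (hh : IsBoundedField P h A m) : m ≤ A := by
  rw [← hh.mean fun _ => 1]
  calc _ ≤ ∫ _, A ∂P := integral_mono (hh.integrable _) (integrable_const _) fun ω => hh.le _ ω
    _ = A := by simp

lemma IsBoundedField.abs_sub_le (hh : IsBoundedField P h A m) (x : Cube n) (ω : Ω) :
    ‖h x ω - m‖ ≤ A := by
  rw [Real.norm_eq_abs, abs_le]
  constructor <;> linarith [hh.nonneg x ω, hh.le x ω, hh.mean_nonneg, hh.mean_le]

lemma IsBoundedField.integral_sub (hh : IsBoundedField P h A m) (x : Cube n) :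
    ∫ ω, (h x ω - m) ∂P = 0 := by
  rw [MeasureTheory.integral_sub (hh.integrable x) (integrable_const _), hh.mean]
  simp

lemma IsBoundedField.integral_sq_sub_le (hh : IsBoundedField P h A m) (x : Cube n) :
    ∫ ω, (h x ω - m) ^ 2 ∂P ≤ A * m := by
  have i1 := hh.integrable x
  calc _ ≤ ∫ ω, ((A - 2 * m) * h x ω + m ^ 2) ∂P := by
        refine integral_mono_of_nonneg (ae_of_all _ fun ω => sq_nonneg _)
          ((i1.const_mul _).add (integrable_const _)) (ae_of_all _ fun ω => ?_)
        have h1 := hh.nonneg x ω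
        have h2 := hh.le x ω
        simp only
        nlinarith
    _ = (A - 2 * m) * m + m ^ 2 := by
        rw [integral_add (i1.const_mul _) (integrable_const _), integral_const_mul, hh.mean]
        simp
    _ ≤ A * m := by nlinarith [sq_nonneg m]

lemma IsBoundedField.integral_mul_sub (hh : IsBoundedField P h A m) {x y : Cube n} (hxy : x ≠ y) :
    ∫ ω, (h x ω - m) * (h y ω - m) ∂P = 0 := by
  rw [(hh.indepFun_sub hxy).integral_fun_mul_eq_mul_integral (hh.aestronglyMeasurable_sub x)
    (hh.aestronglyMeasurable_sub y), hh.integral_sub]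
  simp

lemma IsBoundedField.integrable_mul_sub (hh : IsBoundedField P h A m) (x y : Cube n) :
    Integrable (fun ω => (h x ω - m) * (h y ω - m)) P :=
  ((hh.integrable y).sub (integrable_const m)).bdd_mul (c := A) (hh.aestronglyMeasurable_sub x)
    (ae_of_all _ fun ω => hh.abs_sub_le x ω)

lemma IsBoundedField.measureReal_avg_le (hh : IsBoundedField P h A m) {r : ℝ} (hr : 0 < r) :
    P.real {ω | r ≤ |avg (fun x => h x ω) - m|} ≤ A * m / (2 ^ n * r ^ 2) := by
  have hsq : ∀ ω, (avg (fun x => h x ω) - m) ^ 2 =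
      (∑ x, ∑ y, (h x ω - m) * (h y ω - m)) / (2 ^ n) ^ 2 := by
    intro ω
    rw [← avg_sub_const, avg, div_pow, sq, Finset.sum_mul_sum]
  have hi : Integrable (fun ω => (avg (fun x => h x ω) - m) ^ 2) P := by
    simp_rw [hsq]
    exact (integrable_finsetSum _ fun x _ => integrable_finsetSum _ fun y _ =>
      hh.integrable_mul_sub x y).div_const _
  have hE : ∫ ω, (avg (fun x => h x ω) - m) ^ 2 ∂P ≤ A * m / 2 ^ n := by
    simp_rw [hsq]
    rw [integral_div, integral_finsetSum _ fun x _ => integrable_finsetSum _ fun y _ =>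
      hh.integrable_mul_sub x y]
    calc _ ≤ (∑ x : Cube n, A * m) / (2 ^ n) ^ 2 := by
          gcongr with x _
          rw [integral_finsetSum _ fun y _ => hh.integrable_mul_sub x y,
            Finset.sum_eq_single_of_mem x (Finset.mem_univ x)
              fun y _ hyx => hh.integral_mul_sub hyx.symm]
          simpa only [sq] using hh.integral_sq_sub_le x
      _ = A * m / 2 ^ n := by
          rw [Finset.sum_const, Finset.card_univ, card_cube, nsmul_eq_mul]
          push_cast
          field_simp
  have hm := mul_meas_ge_le_integral_of_nonneg (ae_of_all P fun ω => sq_nonneg _) hi (r ^ 2)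
  rw [← div_div, le_div_iff₀ (by positivity), mul_comm]
  refine le_trans ?_ (hm.trans hE)
  refine mul_le_mul_of_nonneg_left (measureReal_mono ?_) (by positivity)
  intro ω hω
  simp only [Set.mem_ofPred_eq] at hω ⊢
  rw [← sq_abs (_ - _)]
  gcongr

/-- The kernel of the quadratic form `energy`. -/
noncomputable def energyKernel (x y : Cube n) : ℝ :=
  (∑ s : Finset (Fin n), (n : ℝ) / s.card * (walsh s x * walsh s y)) / (2 ^ n) ^ 2

lemma energy_eq_sum_kernel (f : Cube n → ℝ) :
    energy f = ∑ x, ∑ y, energyKernel x y * (f x * f y) := by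
  have h1 : ∀ s : Finset (Fin n), (n : ℝ) / s.card * coeff f s ^ 2 =
      ∑ x, ∑ y, (n : ℝ) / s.card * (walsh s x * walsh s y) * (f x * f y) / (2 ^ n) ^ 2 := by
    intro s
    rw [coeff, div_pow, sq, Finset.sum_mul_sum, mul_div_assoc', Finset.mul_sum, Finset.sum_div]
    refine Finset.sum_congr rfl fun x _ => ?_
    rw [Finset.mul_sum, Finset.sum_div]
    exact Finset.sum_congr rfl fun y _ => by ring
  simp_rw [energy, h1]
  rw [Finset.sum_comm]
  refine Finset.sum_congr rfl fun x _ => ?_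
  rw [Finset.sum_comm]
  refine Finset.sum_congr rfl fun y _ => ?_
  rw [energyKernel, div_mul_eq_mul_div, Finset.sum_mul, Finset.sum_div]

lemma energyKernel_comm (x y : Cube n) : energyKernel x y = energyKernel y x := by
  simp [energyKernel, mul_comm (walsh _ x)]

lemma energyKernel_self_le (x : Cube n) : energyKernel x x ≤ 4 / 2 ^ n := by
  simp only [energyKernel, walsh_mul_self, mul_one]
  rw [div_le_div_iff₀ (by positivity) (by positivity)]
  have := sum_div_card_le (n := n)
  have h2 : (0 : ℝ) < 2 ^ n := by positivity
  nlinarith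

lemma sum_sq_energyKernel_le : ∑ x : Cube n, ∑ y, energyKernel x y ^ 2 ≤ n ^ 2 / 2 ^ n := by
  have h1 : ∀ x y : Cube n, energyKernel x y ^ 2 =
      (∑ s : Finset (Fin n), ∑ t : Finset (Fin n), (n : ℝ) / s.card * ((n : ℝ) / t.card) *
        ((walsh s x * walsh t x) * (walsh s y * walsh t y))) / (2 ^ n) ^ 4 := by
    intro x y
    rw [energyKernel, div_pow, ← pow_mul, sq, Finset.sum_mul_sum]
    congr 1
    exact Finset.sum_congr rfl fun s _ => Finset.sum_congr rfl fun t _ => by ring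
  have h2 : ∑ x : Cube n, ∑ y, energyKernel x y ^ 2 =
      (∑ s : Finset (Fin n), ((n : ℝ) / s.card) ^ 2) / (2 ^ n) ^ 2 := by
    calc _ = (∑ s : Finset (Fin n), ∑ t : Finset (Fin n), (n : ℝ) / s.card * ((n : ℝ) / t.card) *
        ((∑ x, walsh s x * walsh t x) * (∑ y, walsh s y * walsh t y))) / (2 ^ n) ^ 4 := by
          simp_rw [h1, ← Finset.sum_div, Finset.sum_mul_sum, Finset.mul_sum]
          congr 1
          calc _ = ∑ x : Cube n, ∑ s : Finset (Fin n), ∑ y, ∑ t : Finset (Fin n), _ :=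
                Finset.sum_congr rfl fun x _ => Finset.sum_comm
            _ = ∑ s : Finset (Fin n), ∑ x : Cube n, ∑ y, ∑ t : Finset (Fin n), _ := Finset.sum_comm
            _ = ∑ s : Finset (Fin n), ∑ x : Cube n, ∑ t : Finset (Fin n), ∑ y, _ :=
                Finset.sum_congr rfl fun s _ => Finset.sum_congr rfl fun x _ => Finset.sum_comm
            _ = _ := Finset.sum_congr rfl fun s _ => Finset.sum_comm
      _ = _ := by
          simp_rw [sum_cube_walsh]
          have : (2 ^ n : ℝ) ≠ 0 := by positivity
          simp only [ite_mul, zero_mul, mul_ite, mul_zero, Finset.sum_ite_eq, Finset.mem_univ,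
            if_true]
          rw [← Finset.sum_mul]
          field_simp
  rw [h2]
  have h3 : ∀ s : Finset (Fin n), ((n : ℝ) / s.card) ^ 2 ≤ n ^ 2 := by
    intro s
    rcases Nat.eq_zero_or_pos s.card with hs | hs
    · rw [hs]; simp
    · gcongr
      exact div_le_self (by positivity) (by exact_mod_cast hs)
  calc _ ≤ (∑ s : Finset (Fin n), (n : ℝ) ^ 2) / (2 ^ n) ^ 2 := by
        exact div_le_div_of_nonneg_right (Finset.sum_le_sum fun s _ => h3 s) (by positivity)
    _ = _ := by
        rw [Finset.sum_const, Finset.card_univ, Fintype.card_finset, Fintype.card_fin,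
          nsmul_eq_mul]
        push_cast
        field_simp

lemma IsBoundedField.integral_mul_four (hh : IsBoundedField P h A m) {x y : Cube n}
    (hxy : x ≠ y) (u v : Cube n) :
    ∫ ω, ((h x ω - m) * (h y ω - m)) * ((h u ω - m) * (h v ω - m)) ∂P =
      (if u = x ∧ v = y then (∫ ω, (h x ω - m) ^ 2 ∂P) * ∫ ω, (h y ω - m) ^ 2 ∂P else 0) +
      (if u = y ∧ v = x then (∫ ω, (h x ω - m) ^ 2 ∂P) * ∫ ω, (h y ω - m) ^ 2 ∂P else 0) := by
  classical
  have hsq : ∫ ω, ((h x ω - m) * (h y ω - m)) * ((h x ω - m) * (h y ω - m)) ∂P =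
      (∫ ω, (h x ω - m) ^ 2 ∂P) * ∫ ω, (h y ω - m) ^ 2 ∂P := by
    have hind : IndepFun (fun ω => (h x ω - m) ^ 2) (fun ω => (h y ω - m) ^ 2) P :=
      (hh.indepFun_sub hxy).comp (measurable_id.pow_const 2) (measurable_id.pow_const 2)
    rw [← hind.integral_fun_mul_eq_mul_integral ((hh.aestronglyMeasurable_sub x).pow 2)
      ((hh.aestronglyMeasurable_sub y).pow 2)]
    exact integral_congr_ae (ae_of_all _ fun ω => by simp only; ring)
  by_cases h1 : u = x ∧ v = y
  · obtain ⟨rfl, rfl⟩ := h1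
    rw [hsq, if_pos ⟨rfl, rfl⟩, if_neg fun hc => hxy hc.1, add_zero]
  by_cases h2 : u = y ∧ v = x
  · rw [if_neg h1, if_pos h2, zero_add, ← hsq, h2.1, h2.2]
    exact integral_congr_ae (ae_of_all _ fun ω => by simp only; ring)
  rw [if_neg h1, if_neg h2, add_zero]
  let c : Cube n → ℕ := fun w => (if w = x then 1 else 0) + (if w = y then 1 else 0) +
    (if w = u then 1 else 0) + (if w = v then 1 else 0)
  have hprod : ∀ ω, ((h x ω - m) * (h y ω - m)) * ((h u ω - m) * (h v ω - m)) =
      ∏ w, (fun s : ℝ => (s - m) ^ c w) (h w ω) := by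
    intro ω
    simp only [c, pow_add, Finset.prod_mul_distrib, pow_ite, pow_one, pow_zero, Finset.prod_ite_eq',
      Finset.mem_univ, if_true]
    ring
  simp_rw [hprod]
  rw [hh.indep.integral_fun_prod_comp (f := fun w s => (s - m) ^ c w) hh.aemeasurable fun w =>
    ((measurable_id.sub_const m).pow_const (c w)).aestronglyMeasurable]
  obtain ⟨w, hw⟩ : ∃ w, c w = 1 := by
    by_contra! hc
    have hx := hc x
    have hy := hc y
    simp only [c, if_true, if_neg hxy, if_neg hxy.symm] at hx hy
    grind
  refine Finset.prod_eq_zero (Finset.mem_univ w) ?_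
  rw [hw]
  simpa using hh.integral_sub w

lemma IsBoundedField.measureReal_energy_le (hh : IsBoundedField P h A m) (hm : 0 < m) :
    P.real {ω | 4 * A * (avg (fun x => h x ω) + m) + A * m ≤ energy fun x => h x ω} ≤
      2 * n ^ 2 / 2 ^ n := by
  classical
  have hA : 0 < A := hm.trans_le hh.mean_le
  let b : Cube n → Cube n → ℝ := fun x y => if x = y then 0 else energyKernel x y
  have hb : ∀ x y, b x y ^ 2 ≤ energyKernel x y ^ 2 := by
    intro x y
    simp only [b]
    split_ifs
    · simp [sq_nonneg]
    · exact le_rfl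
  have hbc : ∀ x y, b x y = b y x := by
    intro x y
    simp only [b, eq_comm (a := x), energyKernel_comm x]
  let O : Ω → ℝ := fun ω => ∑ x, ∑ y, b x y * ((h x ω - m) * (h y ω - m))
  have hdiag : ∀ ω, energy (fun x => h x ω) ≤ 4 * A * (avg (fun x => h x ω) + m) + O ω := by
    intro ω
    rw [← energy_sub_const _ m, energy_eq_sum_kernel]
    have e1 : ∀ x y, energyKernel x y * ((h x ω - m) * (h y ω - m)) =
        (if x = y then energyKernel x x * (h x ω - m) ^ 2 else 0) +
          b x y * ((h x ω - m) * (h y ω - m)) := by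
      intro x y
      simp only [b]
      split_ifs with hxy
      · subst hxy; ring
      · ring
    simp_rw [e1, Finset.sum_add_distrib]
    simp only [Finset.sum_ite_eq, Finset.mem_univ, if_true]
    refine add_le_add ?_ le_rfl
    calc _ ≤ ∑ x, 4 / 2 ^ n * (A * h x ω + A * m) := by
          refine Finset.sum_le_sum fun x _ => ?_
          have h1 := hh.nonneg x ω
          have h2 := hh.le x ω
          have h3 := hh.mean_le
          have h4 : (h x ω - m) ^ 2 ≤ A * h x ω + A * m := by nlinarith
          exact mul_le_mul (energyKernel_self_le x) h4 (sq_nonneg _) (by positivity)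
      _ = _ := by
          rw [← Finset.mul_sum, Finset.sum_add_distrib, ← Finset.mul_sum, Finset.sum_const,
            Finset.card_univ, card_cube, nsmul_eq_mul, avg]
          push_cast
          field_simp
  have hint4 : ∀ x y u v, Integrable (fun ω => b x y * b u v *
      (((h x ω - m) * (h y ω - m)) * ((h u ω - m) * (h v ω - m)))) P := by
    intro x y u v
    refine Integrable.const_mul ?_ _
    refine (hh.integrable_mul_sub u v).bdd_mul (c := A * A)
      (hh.integrable_mul_sub x y).aestronglyMeasurable (ae_of_all _ fun ω => ?_)
    rw [norm_mul]
    exact mul_le_mul (hh.abs_sub_le _ _) (hh.abs_sub_le _ _) (norm_nonneg _) hA.le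
  have hOsq : ∀ ω, O ω ^ 2 = ∑ x, ∑ y, ∑ u, ∑ v, b x y * b u v *
      (((h x ω - m) * (h y ω - m)) * ((h u ω - m) * (h v ω - m))) := by
    intro ω
    simp only [O, sq, Finset.sum_mul, Finset.mul_sum]
    exact Finset.sum_congr rfl fun x _ => Finset.sum_congr rfl fun y _ =>
      Finset.sum_congr rfl fun u _ => Finset.sum_congr rfl fun v _ => by ring
  have hOi : Integrable (fun ω => O ω ^ 2) P := by
    simp_rw [hOsq]
    exact integrable_finsetSum _ fun x _ => integrable_finsetSum _ fun y _ =>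
      integrable_finsetSum _ fun u _ => integrable_finsetSum _ fun v _ => hint4 x y u v
  have hOE : ∫ ω, O ω ^ 2 ∂P ≤ 2 * n ^ 2 / 2 ^ n * (A * m) ^ 2 := by
    simp_rw [hOsq]
    rw [integral_finsetSum _ fun x _ => integrable_finsetSum _ fun y _ =>
      integrable_finsetSum _ fun u _ => integrable_finsetSum _ fun v _ => hint4 x y u v]
    calc _ ≤ ∑ x : Cube n, ∑ y, 2 * (A * m) ^ 2 * energyKernel x y ^ 2 := by
          refine Finset.sum_le_sum fun x _ => ?_
          rw [integral_finsetSum _ fun y _ =>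
            integrable_finsetSum _ fun u _ => integrable_finsetSum _ fun v _ => hint4 x y u v]
          refine Finset.sum_le_sum fun y _ => ?_
          rcases eq_or_ne x y with hxy | hxy
          · simp only [b, if_pos hxy, zero_mul, Finset.sum_const_zero, integral_zero]
            positivity
          rw [integral_finsetSum _ fun u _ => integrable_finsetSum _ fun v _ => hint4 x y u v]
          set V := (∫ ω, (h x ω - m) ^ 2 ∂P) * ∫ ω, (h y ω - m) ^ 2 ∂P with hV
          have hVle : V ≤ (A * m) ^ 2 := by
            rw [sq]
            exact mul_le_mul (hh.integral_sq_sub_le x) (hh.integral_sq_sub_le y)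
              (integral_nonneg fun ω => sq_nonneg _) (by positivity)
          have hterm : ∀ u v, ∫ ω, b x y * b u v *
              (((h x ω - m) * (h y ω - m)) * ((h u ω - m) * (h v ω - m))) ∂P =
              (if v = y then if u = x then b x y ^ 2 * V else 0 else 0) +
              (if v = x then if u = y then b x y ^ 2 * V else 0 else 0) := by
            intro u v
            rw [integral_const_mul]
            rcases eq_or_ne u v with huv | huv
            · subst huv
              simp only [b, if_true, mul_zero, zero_mul]
              grind
            · rw [hh.integral_mul_four hxy u v, ← hV]
              have := hbc x y
              grind
          have hsum : ∑ u, ∑ v, ∫ ω, b x y * b u v *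
              (((h x ω - m) * (h y ω - m)) * ((h u ω - m) * (h v ω - m))) ∂P =
              2 * (b x y ^ 2 * V) := by
            simp_rw [hterm, Finset.sum_add_distrib]
            simp only [Finset.sum_ite_eq', Finset.mem_univ, if_true]
            ring
          have : ∀ u, ∫ ω, ∑ v, b x y * b u v *
              (((h x ω - m) * (h y ω - m)) * ((h u ω - m) * (h v ω - m))) ∂P =
              ∑ v, ∫ ω, b x y * b u v *
              (((h x ω - m) * (h y ω - m)) * ((h u ω - m) * (h v ω - m))) ∂P :=
            fun u => integral_finsetSum _ fun v _ => hint4 x y u v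
          simp_rw [this]
          rw [hsum]
          have hV0 : 0 ≤ V := mul_nonneg (integral_nonneg fun ω => sq_nonneg _)
            (integral_nonneg fun ω => sq_nonneg _)
          calc 2 * (b x y ^ 2 * V) ≤ 2 * (energyKernel x y ^ 2 * (A * m) ^ 2) := by
                exact mul_le_mul_of_nonneg_left
                  (mul_le_mul (hb x y) hVle hV0 (sq_nonneg _)) (by norm_num)
            _ = _ := by ring
      _ ≤ _ := by
          simp_rw [← Finset.mul_sum]
          calc _ ≤ 2 * (A * m) ^ 2 * (n ^ 2 / 2 ^ n) := by
                gcongr; exact sum_sq_energyKernel_le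
            _ = _ := by ring
  have hmk := mul_meas_ge_le_integral_of_nonneg (ae_of_all P fun ω => sq_nonneg _) hOi ((A * m) ^ 2)
  have hAm : 0 < (A * m) ^ 2 := by positivity
  refine le_of_mul_le_mul_left ?_ hAm
  rw [mul_comm _ (2 * (n : ℝ) ^ 2 / 2 ^ n)]
  refine le_trans ?_ (hmk.trans hOE)
  refine mul_le_mul_of_nonneg_left (measureReal_mono ?_) hAm.le
  intro ω hω
  simp only [Set.mem_ofPred_eq] at hω ⊢
  have : A * m ≤ O ω := by linarith [hdiag ω]
  gcongr

end Field

section Deviation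

/-- A nondecreasing function that is close to the identity on a fine grid is close to it
everywhere. -/
lemma abs_sub_le_of_grid {Y : ℝ → ℝ} {T η : ℝ} (hT : 0 < T) {N : ℕ} (hN : 2 * T ≤ η * N)
    (hY : MonotoneOn Y (Set.Icc 0 T))
    (hgrid : ∀ j ∈ Finset.range (N + 1), |Y (j * T / N) - j * T / N| < η / 2) {t : ℝ}
    (ht : t ∈ Set.Icc 0 T) : |Y t - t| ≤ η := by
  have hN0 : (0 : ℝ) < N := by
    rcases Nat.eq_zero_or_pos N with h | h
    · rw [h] at hN; simp at hN; linarith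
    · exact_mod_cast h
  have hgap : T / N ≤ η / 2 := by
    rw [div_le_iff₀ hN0]; linarith
  have hmem : ∀ j : ℕ, j ≤ N → (j : ℝ) * T / N ∈ Set.Icc 0 T := by
    intro j hj
    have : (j : ℝ) ≤ N := by exact_mod_cast hj
    refine ⟨by positivity, ?_⟩
    rw [div_le_iff₀ hN0]
    nlinarith
  let k := ⌊t * N / T⌋₊
  have htN : 0 ≤ t * N / T := div_nonneg (mul_nonneg ht.1 hN0.le) hT.le
  have hk1 : (k : ℝ) * T / N ≤ t := by
    have := Nat.floor_le htN
    rw [div_le_iff₀ hN0]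
    rwa [le_div_iff₀ hT] at this
  have hkN : k ≤ N := by
    have : (k : ℝ) ≤ N := by
      refine (Nat.floor_le htN).trans ?_
      rw [div_le_iff₀ hT]
      nlinarith [ht.2]
    exact_mod_cast this
  have hk2 : t ≤ (k : ℝ) * T / N + T / N := by
    have := (Nat.lt_floor_add_one (t * N / T)).le
    rw [div_le_iff₀ hT] at this
    rw [← add_div, le_div_iff₀ hN0]
    calc t * N ≤ _ := this
      _ = _ := by ring
  have g1 := abs_lt.1 (hgrid k (Finset.mem_range.2 (by omega)))
  have m1 := hY (hmem k hkN) ht hk1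
  rw [abs_le]
  constructor
  · linarith
  · rcases eq_or_lt_of_le hkN with h | h
    · have hkT : (k : ℝ) * T / N = T := by rw [h]; field_simp
      have : t = T := le_antisymm ht.2 (hkT ▸ hk1)
      rw [hkT] at g1
      rw [this]
      linarith
    · have g2 := abs_lt.1 (hgrid (k + 1) (Finset.mem_range.2 (by omega)))
      have hk3 : ((k + 1 : ℕ) : ℝ) * T / N = (k : ℝ) * T / N + T / N := by push_cast; ring
      have m2 := hY ht (hmem (k + 1) h) (hk3 ▸ hk2)
      rw [hk3] at g2 m2
      linarith

lemma deviationProb_le_of_sum {Ξ : Type*} [MeasurableSpace Ξ] {Q : Measure Ξ} [IsFiniteMeasure Q]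
    {x : ℕ → Ξ → ℝ} (hx : ∀ i ξ, 0 ≤ x i ξ) {Y : ℝ → Ξ → ℝ} {B : Set Ξ} {l : ℝ → ℕ}
    (hl : Monotone l) {D : ℝ} (hD : 0 < D) {T η : ℝ} (hT : 0 < T) {N : ℕ}
    (hN : 2 * T ≤ η * N)
    (hY : ∀ ξ ∉ B, ∀ t ∈ Set.Icc 0 T, Y t ξ = (∑ i ∈ Finset.range (l t), x i ξ) / D) {u v K : ℝ}
    (hmean : ∀ t ∈ Set.Icc 0 T, |l t * u / D - t| ≤ η / 4) (hv0 : 0 ≤ v)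
    (hv : ∀ L : ℕ, Q.real {ξ | η * D / 4 ≤ |∑ i ∈ Finset.range L, x i ξ - L * u|} ≤ L * v)
    (hK : ∀ t ∈ Set.Icc 0 T, (l t : ℝ) ≤ K) :
    deviationProb Q Y T η ≤ Q.real B + (N + 1) * (K * v) := by
  have hN0 : (0 : ℝ) < N := by
    rcases Nat.eq_zero_or_pos N with h | h
    · rw [h] at hN; simp at hN; linarith
    · exact_mod_cast h
  have hmem : ∀ j ∈ Finset.range (N + 1), (j : ℝ) * T / N ∈ Set.Icc 0 T := by
    intro j hj
    have : (j : ℝ) ≤ N := by exact_mod_cast Nat.lt_succ_iff.1 (Finset.mem_range.1 hj)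
    refine ⟨by positivity, ?_⟩
    rw [div_le_iff₀ hN0]
    nlinarith
  let G : ℕ → Set Ξ := fun j =>
    {ξ | η * D / 4 ≤ |∑ i ∈ Finset.range (l (j * T / N)), x i ξ - l (j * T / N) * u|}
  have hsub : {ξ | η < ⨆ t : Set.Icc (0 : ℝ) T, |Y t ξ - t|} ⊆
      B ∪ ⋃ j ∈ Finset.range (N + 1), G j := by
    intro ξ hξ
    by_contra hc
    rw [Set.mem_union, not_or] at hc
    have hG : ∀ j ∈ Finset.range (N + 1), ξ ∉ G j := fun j hj hjG =>
      hc.2 (Set.mem_biUnion (Finset.mem_coe.2 hj) hjG)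
    have : Nonempty (Set.Icc (0 : ℝ) T) := ⟨⟨0, le_rfl, hT.le⟩⟩
    obtain ⟨t, ht⟩ := exists_lt_of_lt_ciSup (show η < ⨆ t : Set.Icc (0 : ℝ) T, |Y t ξ - t| from hξ)
    refine absurd ht (not_lt.2 (abs_sub_le_of_grid (Y := fun t => Y t ξ) hT hN ?_ ?_ t.2))
    · intro s hs t ht hst
      simp only [hY ξ hc.1 s hs, hY ξ hc.1 t ht]
      refine div_le_div_of_nonneg_right ?_ hD.le
      exact Finset.sum_le_sum_of_subset_of_nonneg (Finset.range_subset_range.2 (hl hst))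
        fun i _ _ => hx i ξ
    · intro j hj
      have h1 := hG j hj
      simp only [G, Set.mem_ofPred_eq, not_le] at h1
      have h2 := hmean _ (hmem j hj)
      simp only [hY ξ hc.1 _ (hmem j hj)]
      set R := ∑ i ∈ Finset.range (l (j * T / N)), x i ξ
      set l' : ℝ := (l (j * T / N) : ℝ)
      have e : R / D - j * T / N = (R - l' * u) / D + (l' * u / D - j * T / N) := by ring
      rw [e]
      refine (abs_add_le _ _).trans_lt ?_
      have h3 : |(R - l' * u) / D| < η / 4 := by
        rw [abs_div, abs_of_pos hD, div_lt_iff₀ hD]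
        linarith
      linarith
  refine (measureReal_mono hsub).trans ((measureReal_union_le _ _).trans ?_)
  refine add_le_add le_rfl ((measureReal_biUnion_finset_le _ _).trans ?_)
  calc _ ≤ ∑ j ∈ Finset.range (N + 1), K * v := by
        refine Finset.sum_le_sum fun j hj => (hv _).trans ?_
        exact mul_le_mul_of_nonneg_right (hK _ (hmem j hj)) hv0
    _ = _ := by simp

variable {Ξ : Type*} [MeasurableSpace Ξ] {Q : Measure Ξ} [IsProbabilityMeasure Q] {n : ℕ}
  {X : ℕ → Ξ → Cube n} {E : ℕ → Ξ → ℝ}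

lemma floor_mul_le {a t T : ℝ} (ha : 0 ≤ a) (ht : t ∈ Set.Icc 0 T) : (⌊a * t⌋₊ : ℝ) ≤ a * T :=
  (Nat.floor_le (mul_nonneg ha ht.1)).trans (mul_le_mul_of_nonneg_left ht.2 ha)

lemma monotone_floor_mul {a : ℝ} (ha : 0 ≤ a) : Monotone fun t : ℝ => ⌊a * t⌋₊ := fun _ _ h =>
  Nat.floor_mono (mul_le_mul_of_nonneg_left h ha)

/-- The deviation of the clock process in a fixed landscape. -/
lemma IsTimedWalk.deviationProb_clock_le (hX : IsTimedWalk Q X E) {a A D T η : ℝ} (ha : 0 ≤ a)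
    (hA : 0 ≤ A) (hD : 0 < D) (hT : 0 < T) (hη : 0 < η) {N : ℕ} (hN : 2 * T ≤ η * N)
    {z : Cube n → ℝ} (hz : ∀ x, 0 < z x)
    (hmean : ∀ t ∈ Set.Icc 0 T,
      |((⌊a * t⌋₊ + 1 : ℕ) : ℝ) * (avg fun x => cutMean A (z x)) / D - t| ≤ η / 4) :
    deviationProb Q (fun t ξ => (∑ i ∈ Finset.range (⌊a * t⌋₊ + 1), z (X i ξ) * E i ξ) / D) T η ≤
      (a * T + 1) * (avg fun x => overshoot A (z x)) +
      (N + 1) * ((a * T + 1) * (4 * (energy (fun x => cutMean A (z x)) +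
        A * avg fun x => cutMean A (z x)) / (η * D / 4) ^ 2)) := by
  have hq : 0 ≤ avg fun x => overshoot A (z x) := by
    unfold avg overshoot; positivity
  have hc : 0 ≤ avg fun x => cutMean A (z x) :=
    div_nonneg (Finset.sum_nonneg fun x _ => cutMean_nonneg hA (hz x)) (by positivity)
  have hen := energy_nonneg fun x => cutMean A (z x)
  have hfl : ∀ t ∈ Set.Icc 0 T, ((⌊a * t⌋₊ + 1 : ℕ) : ℝ) ≤ a * T + 1 := by
    intro t ht
    push_cast
    linarith [floor_mul_le ha ht]
  have := deviationProb_le_of_sum (Q := Q) (x := fun i ξ => cut A (z (X i ξ)) (E i ξ))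
    (Y := fun t ξ => (∑ i ∈ Finset.range (⌊a * t⌋₊ + 1), z (X i ξ) * E i ξ) / D)
    (B := {ξ | ∃ i < ⌊a * T⌋₊ + 1, z (X i ξ) * E i ξ ≠ cut A (z (X i ξ)) (E i ξ)})
    (l := fun t => ⌊a * t⌋₊ + 1) (fun i ξ => cut_nonneg _ _ _)
    (fun s t h => Nat.add_le_add_right (monotone_floor_mul ha h) 1) hD hT hN ?_ hmean
    (v := 4 * (energy (fun x => cutMean A (z x)) +
        A * avg fun x => cutMean A (z x)) / (η * D / 4) ^ 2) (by positivity) (fun L => ?_) hfl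
  · refine this.trans (add_le_add ?_ le_rfl)
    refine (hX.measureReal_exists_cut_ne_le hA hz _).trans ?_
    exact mul_le_mul_of_nonneg_right (hfl T ⟨hT.le, le_rfl⟩) hq
  · intro ξ hξ t ht
    simp only [Set.mem_ofPred_eq, not_exists, not_and, not_not] at hξ
    congr 1
    refine Finset.sum_congr rfl fun i hi => hξ i ?_
    have := monotone_floor_mul ha ht.2
    simp only at this
    rw [Finset.mem_range] at hi
    omega
  · refine (hX.measureReal_sum_cut_le hA hz L (by positivity)).trans (le_of_eq ?_)
    ring

/-- The deviation of the centering process in a fixed landscape. -/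
lemma IsCubeWalk.deviationProb_centering_le (hX : IsCubeWalk Q X) {a D T η : ℝ} (ha : 0 ≤ a)
    (hD : 0 < D) (hT : 0 < T) (hη : 0 < η) {N : ℕ} (hN : 2 * T ≤ η * N)
    {h : Cube n → ℝ} (hh : ∀ x, 0 ≤ h x)
    (hmean : ∀ t ∈ Set.Icc 0 T, |(⌊a * t⌋₊ : ℝ) * avg h / D - t| ≤ η / 4) :
    deviationProb Q (fun t ξ => (∑ i ∈ Finset.range ⌊a * t⌋₊, step h (X i ξ)) / D) T η ≤
      (N + 1) * ((a * T + 1) * (energy h / (η * D / 4) ^ 2)) := by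
  have hen := energy_nonneg h
  have := deviationProb_le_of_sum (Q := Q) (x := fun i ξ => step h (X i ξ))
    (Y := fun t ξ => (∑ i ∈ Finset.range ⌊a * t⌋₊, step h (X i ξ)) / D)
    (B := ∅) (l := fun t => ⌊a * t⌋₊)
    (fun i ξ => Finset.sum_nonneg fun y _ => mul_nonneg (p_nonneg _ _) (hh y))
    (monotone_floor_mul ha) hD hT hN (fun ξ _ t _ => rfl) hmean
    (v := energy h / (η * D / 4) ^ 2) (by positivity) (fun L => ?_)
    (K := a * T + 1) (fun t ht => (floor_mul_le ha ht).trans (by linarith))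
  · simpa using this
  · refine (avg_step hX.pos h ▸ hX.measureReal_sum_le (step h) L (by positivity)).trans ?_
    rw [mul_div_assoc]
    gcongr
    exact energy_step_le hX.pos h

lemma abs_mul_avg_div_sub_le {a m D T η d w t L : ℝ} (ha : 1 ≤ a) (hm : 0 ≤ m) (hD : 0 < D)
    (ht : t ∈ Set.Icc 0 T) (hL : |L - a * t| ≤ 1) (hL0 : 0 ≤ L) (hw : |w - m| ≤ d * m)
    (h1 : a * m / D ≤ 2) (hd0 : 0 ≤ d) (hd : d * (16 * (T + 1)) ≤ η)
    (h2 : m / D + T * |a * m / D - 1| ≤ η / 8) : |L * w / D - t| ≤ η / 4 := by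
  have hT : 0 ≤ T := ht.1.trans ht.2
  have e : L * w / D - t = L * (w - m) / D + ((L - a * t) * (m / D) + t * (a * m / D - 1)) := by
    field_simp
    ring
  have hLT : L ≤ a * (T + 1) := by
    have := (abs_le.1 hL).2
    nlinarith [ht.2]
  have b1 : |L * (w - m) / D| ≤ η / 8 := by
    rw [abs_div, abs_mul, abs_of_nonneg hL0, abs_of_pos hD, div_le_iff₀ hD]
    have h3 : a * m ≤ 2 * D := by rwa [div_le_iff₀ hD] at h1
    calc L * |w - m| ≤ a * (T + 1) * (d * m) := by gcongr
      _ = d * (T + 1) * (a * m) := by ring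
      _ ≤ d * (T + 1) * (2 * D) := by gcongr
      _ ≤ η / 8 * D := by nlinarith
  have b2 : |(L - a * t) * (m / D)| ≤ m / D := by
    rw [abs_mul, abs_of_nonneg (div_nonneg hm hD.le)]
    exact mul_le_of_le_one_left (div_nonneg hm hD.le) hL
  have b3 : |t * (a * m / D - 1)| ≤ T * |a * m / D - 1| := by
    rw [abs_mul, abs_of_nonneg ht.1]
    exact mul_le_mul_of_nonneg_right ht.2 (abs_nonneg _)
  rw [e]
  refine (abs_add_le _ _).trans ?_
  have := abs_add_le ((L - a * t) * (m / D)) (t * (a * m / D - 1))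
  linarith

lemma abs_floor_sub_le {x : ℝ} (hx : 0 ≤ x) : |(⌊x⌋₊ : ℝ) - x| ≤ 1 := by
  rw [abs_le]
  constructor <;> linarith [Nat.floor_le hx, Nat.lt_floor_add_one x]

lemma abs_floor_add_one_sub_le {x : ℝ} (hx : 0 ≤ x) : |((⌊x⌋₊ + 1 : ℕ) : ℝ) - x| ≤ 1 := by
  push_cast
  rw [abs_le]
  constructor <;> linarith [Nat.floor_le hx, Nat.lt_floor_add_one x]

end Deviation

section Regular

variable {Ω : Type*} [MeasurableSpace Ω] {P : Measure Ω} [IsProbabilityMeasure P] {n : ℕ}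
  {h : Cube n → Ω → ℝ} {A m : ℝ}

/-- The landscapes in which the empirical mean and the energy of the field `h` are typical. -/
def regularSet (h : Cube n → Ω → ℝ) (A m d : ℝ) : Set Ω :=
  {ω | |avg (fun x => h x ω) - m| ≤ d * m ∧ energy (fun x => h x ω) ≤ 13 * A * m}

lemma IsBoundedField.measureReal_compl_regularSet_le (hh : IsBoundedField P h A m) (hm : 0 < m)
    {d : ℝ} (hd : 0 < d) (hd1 : d ≤ 1) :
    P.real (regularSet h A m d)ᶜ ≤ A / (2 ^ n * m * d ^ 2) + 2 * n ^ 2 / 2 ^ n := by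
  have hA : 0 < A := hm.trans_le hh.mean_le
  have hsub : (regularSet h A m d)ᶜ ⊆ {ω | d * m ≤ |avg (fun x => h x ω) - m|} ∪
      {ω | 4 * A * (avg (fun x => h x ω) + m) + A * m ≤ energy fun x => h x ω} := by
    intro ω hω
    by_contra hc
    simp only [Set.mem_union, Set.mem_ofPred_eq, not_or, not_le] at hc
    refine hω ⟨hc.1.le, hc.2.le.trans ?_⟩
    have h1 := (abs_lt.1 hc.1).2
    have : avg (fun x => h x ω) ≤ 2 * m := by nlinarith
    nlinarith [mul_le_mul_of_nonneg_left this hA.le]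
  refine (measureReal_mono hsub).trans ((measureReal_union_le _ _).trans ?_)
  refine add_le_add ((hh.measureReal_avg_le (by positivity)).trans (le_of_eq ?_))
    (hh.measureReal_energy_le hm)
  field_simp

end Regular

section Modes

variable {Ω : Type*} [MeasurableSpace Ω] {P : Measure Ω} [IsFiniteMeasure P] {f : ℕ → Ω → ℝ}
  {b : ℕ → ℝ}

lemma ae_tendsto_zero_of_summable (hf : ∀ n ω, 0 ≤ f n ω) (hb : Summable b)
    (h : ∀ r : ℝ, 0 < r → ∃ C : ℝ, ∀ᶠ n in atTop, P.real {ω | r ≤ f n ω} ≤ C * b n) :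
    ∀ᵐ ω ∂P, Tendsto (fun n => f n ω) atTop (𝓝 0) := by
  have hk : ∀ k : ℕ, ∀ᵐ ω ∂P, ∀ᶠ n in atTop, f n ω < 1 / (k + 1) := by
    intro k
    obtain ⟨C, hC⟩ := h (1 / (k + 1)) (by positivity)
    obtain ⟨n₀, hn₀⟩ := eventually_atTop.1 hC
    have hs : ∑' n, P {ω | 1 / ((k : ℝ) + 1) ≤ f (n + n₀) ω} ≠ ⊤ := by
      have hsum : Summable fun n => C * b (n + n₀) := ((summable_nat_add_iff n₀).2 hb).mul_left C
      refine ne_top_of_le_ne_top (ENNReal.ofReal_ne_top (r := ∑' n, C * b (n + n₀))) ?_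
      have h0 : ∀ n, 0 ≤ C * b (n + n₀) := fun n =>
        measureReal_nonneg.trans (hn₀ (n + n₀) (by omega))
      rw [ENNReal.ofReal_tsum_of_nonneg h0 hsum]
      refine ENNReal.tsum_le_tsum fun n => ?_
      rw [← ofReal_measureReal]
      exact ENNReal.ofReal_le_ofReal (hn₀ (n + n₀) (by omega))
    filter_upwards [ae_eventually_notMem hs] with ω hω
    rw [← map_add_atTop_eq_nat n₀, eventually_map]
    filter_upwards [hω] with n hn
    exact not_le.1 hn
  filter_upwards [ae_all_iff.2 hk] with ω hω
  rw [Metric.tendsto_atTop']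
  intro ε hε
  obtain ⟨k, hk⟩ := exists_nat_one_div_lt hε
  obtain ⟨n₀, hn₀⟩ := eventually_atTop.1 (hω k)
  refine ⟨n₀, fun n hn => ?_⟩
  rw [Real.dist_eq, sub_zero, abs_of_nonneg (hf n ω)]
  exact (hn₀ n hn.le).trans hk

lemma tendstoInMeasure_zero_of_tendsto (hf : ∀ n ω, 0 ≤ f n ω) (hb : Tendsto b atTop (𝓝 0))
    (h : ∀ r : ℝ, 0 < r → ∃ C : ℝ, ∀ᶠ n in atTop, P.real {ω | r ≤ f n ω} ≤ C * b n) :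
    TendstoInMeasure P f atTop fun _ => 0 := by
  rw [tendstoInMeasure_iff_measureReal_dist]
  intro r hr
  obtain ⟨C, hC⟩ := h r hr
  have hlim : Tendsto (fun n => C * b n) atTop (𝓝 0) := by simpa using hb.const_mul C
  refine squeeze_zero' (Eventually.of_forall fun n => measureReal_nonneg) ?_ hlim
  filter_upwards [hC] with n hn
  simpa only [Real.dist_eq, sub_zero, abs_of_nonneg (hf n _)] using hn

end Modes

section Asymptotics

variable {Ω Ξ : Type*} [MeasurableSpace Ω] [MeasurableSpace Ξ] {P : Measure Ω} {Q : Measure Ξ}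
  [IsProbabilityMeasure P] [IsProbabilityMeasure Q] {a A D m : ℕ → ℝ}

lemma exists_grid_size (T : ℝ) {η : ℝ} (hη : 0 < η) : ∃ N : ℕ, 2 * T ≤ η * N := by
  obtain ⟨N, hN⟩ := exists_nat_ge (2 * T / η)
  exact ⟨N, by rwa [div_le_iff₀' hη] at hN⟩

lemma eventually_ratio_bounds (ha : Tendsto a atTop atTop) (hD : ∀ᶠ n in atTop, 0 < D n)
    (h1 : Tendsto (fun n => a n * m n / D n) atTop (𝓝 1)) (T : ℝ) {η : ℝ} (hη : 0 < η) :
    ∀ᶠ n in atTop, 1 ≤ a n ∧ 0 < m n ∧ a n * m n / D n ≤ 2 ∧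
      m n / D n + T * |a n * m n / D n - 1| ≤ η / 8 := by
  have hlim : Tendsto (fun n => m n / D n + T * |a n * m n / D n - 1|) atTop (𝓝 0) := by
    have e1 : Tendsto (fun n => (a n * m n / D n) / a n) atTop (𝓝 0) := h1.div_atTop ha
    have e2 : Tendsto (fun n => T * |a n * m n / D n - 1|) atTop (𝓝 0) := by
      have := ((h1.sub_const 1).abs).const_mul T
      simpa using this
    have e3 : Tendsto (fun n => m n / D n) atTop (𝓝 0) := by
      refine e1.congr' ?_
      filter_upwards [ha.eventually_gt_atTop 0] with n hn
      field_simp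
    simpa using e3.add e2
  filter_upwards [ha.eventually_ge_atTop 1, hD, h1.eventually (lt_mem_nhds one_pos),
    h1.eventually (ge_mem_nhds one_lt_two), hlim.eventually (ge_mem_nhds (by positivity :
      (0 : ℝ) < η / 8))] with n e1 e2 e3 e4 e5
  refine ⟨e1, ?_, e4, e5⟩
  have : 0 < a n * m n := by
    have := mul_pos e3 e2
    rwa [div_mul_cancel₀ _ e2.ne'] at this
  exact pos_of_mul_pos_right this (by linarith)

lemma exists_clock_deviation_bound {X : (n : ℕ) → ℕ → Ξ → Cube n} {E : ℕ → ℕ → Ξ → ℝ}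
    (hX : ∀ n, 1 ≤ n → IsTimedWalk Q (X n) (E n)) {z : (n : ℕ) → Cube n → Ω → ℝ}
    (hz : ∀ᶠ n in atTop, ∀ x ω, 0 < z n x ω) {q : ℕ → ℝ}
    (hf : ∀ᶠ n in atTop,
      IsBoundedField P (fun x ω => cutMean (A n) (z n x ω)) (A n) (m n))
    (hq : ∀ᶠ n in atTop, IsBoundedField P (fun x ω => overshoot (A n) (z n x ω)) 1 (q n))
    (ha : Tendsto a atTop atTop) (hD : ∀ᶠ n in atTop, 0 < D n)
    (h1 : Tendsto (fun n => a n * m n / D n) atTop (𝓝 1))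
    (h2 : Tendsto (fun n => A n / (a n * m n)) atTop (𝓝 0))
    (h3 : Tendsto (fun n => a n * q n) atTop (𝓝 0)) {T η r : ℝ} (hT : 0 < T) (hη : 0 < η)
    (hr : 0 < r) :
    ∃ C : ℝ, ∀ᶠ n in atTop, P.real {ω | r ≤ deviationProb Q (fun t ξ =>
      (∑ i ∈ Finset.range (⌊a n * t⌋₊ + 1), z n (X n i ξ) ω * E n i ξ) / D n) T η} ≤
      C * (a n / 2 ^ n * (A n / (a n * m n) + a n * q n) + n ^ 2 / 2 ^ n) := by
  obtain ⟨N, hN⟩ := exists_grid_size T hη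
  obtain ⟨d, hd0, hd1, hd⟩ : ∃ d : ℝ, 0 < d ∧ d ≤ 1 ∧ d * (16 * (T + 1)) ≤ η := by
    refine ⟨min 1 (η / (16 * (T + 1))), by positivity, min_le_left _ _, ?_⟩
    rw [← le_div_iff₀ (by positivity)]
    exact min_le_right _ _
  have l1 : Tendsto (fun n => (T + 1) * (a n * q n)) atTop (𝓝 0) := by
    simpa using h3.const_mul (T + 1)
  have l2 : Tendsto (fun n => (N + 1) * (T + 1) * (3840 / η ^ 2) * (A n / (a n * m n))) atTop
      (𝓝 0) := by
    simpa using h2.const_mul ((N + 1) * (T + 1) * (3840 / η ^ 2))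
  refine ⟨1 / d ^ 2 + 2 + 16 * (T + 1) ^ 2 / r ^ 2, ?_⟩
  filter_upwards [hz, hf, hq, hD, eventually_ratio_bounds ha hD h1 T hη, eventually_ge_atTop 1,
    l1.eventually (gt_mem_nhds (by positivity : (0 : ℝ) < r / 4)),
    l2.eventually (gt_mem_nhds (by positivity : (0 : ℝ) < r / 4))]
    with n hz hf hq hD ⟨ha1, hm, hr2, hr3⟩ hn l1 l2
  have hA : 0 < A n := hm.trans_le hf.mean_le
  have ha0 : 0 < a n := by linarith
  set ρ := r / (4 * (T + 1) * a n) with hρ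
  have hρ0 : 0 < ρ := by positivity
  have hsub : {ω | r ≤ deviationProb Q (fun t ξ =>
      (∑ i ∈ Finset.range (⌊a n * t⌋₊ + 1), z n (X n i ξ) ω * E n i ξ) / D n) T η} ⊆
      (regularSet (fun x ω => cutMean (A n) (z n x ω)) (A n) (m n) d)ᶜ ∪
      {ω | ρ ≤ |avg (fun x => overshoot (A n) (z n x ω)) - q n|} := by
    intro ω hω
    by_contra hc
    simp only [Set.mem_union, Set.mem_compl_iff, not_or, not_not, Set.mem_ofPred_eq, not_le,
      regularSet] at hc hω
    obtain ⟨⟨c1, c2⟩, c3⟩ := hc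
    have key := (hX n hn).deviationProb_clock_le (z := fun x => z n x ω) ha0.le hA.le hD hT hη hN
      (fun x => hz x ω) fun t ht => abs_mul_avg_div_sub_le ha1 hm.le hD ht
        (abs_floor_add_one_sub_le (mul_nonneg ha0.le ht.1)) (by positivity) c1 hr2 hd0.le hd hr3
    refine absurd (hω.trans key) (not_le.2 ?_)
    have haT : a n * T + 1 ≤ a n * (T + 1) := by linarith
    have b1 : (a n * T + 1) * (avg fun x => overshoot (A n) (z n x ω)) < r / 2 := by
      have hv : avg (fun x => overshoot (A n) (z n x ω)) ≤ q n + ρ := by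
        linarith [(abs_lt.1 c3).2]
      have hv0 : 0 ≤ q n + ρ := by linarith [hq.mean_nonneg]
      calc _ ≤ a n * (T + 1) * (q n + ρ) :=
            mul_le_mul haT hv (by unfold avg overshoot; positivity) (by positivity)
        _ = (T + 1) * (a n * q n) + r / 4 := by rw [hρ]; field_simp
        _ < r / 2 := by linarith
    have hv : avg (fun x => cutMean (A n) (z n x ω)) ≤ 2 * m n := by
      have := (abs_le.1 c1).2
      nlinarith
    have b2 : (N + 1) * ((a n * T + 1) * (4 * (energy (fun x => cutMean (A n) (z n x ω)) +
        A n * avg fun x => cutMean (A n) (z n x ω)) / (η * D n / 4) ^ 2)) < r / 4 := by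
      calc _ ≤ (N + 1) * (a n * (T + 1) * (4 * (13 * A n * m n + A n * (2 * m n)) /
            (η * D n / 4) ^ 2)) := by
            have : 0 ≤ energy (fun x => cutMean (A n) (z n x ω)) +
                A n * avg fun x => cutMean (A n) (z n x ω) :=
              add_nonneg (energy_nonneg _) (mul_nonneg hA.le (div_nonneg
                (Finset.sum_nonneg fun x _ => cutMean_nonneg hA.le (hz x ω)) (by positivity)))
            gcongr
        _ = (N + 1) * (T + 1) * (960 / η ^ 2) * (A n / (a n * m n)) * (a n * m n / D n) ^ 2 := by
            field_simp
            ring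
        _ ≤ (N + 1) * (T + 1) * (960 / η ^ 2) * (A n / (a n * m n)) * 2 ^ 2 := by
            gcongr
        _ = (N + 1) * (T + 1) * (3840 / η ^ 2) * (A n / (a n * m n)) := by ring
        _ < r / 4 := l2
    linarith
  refine (measureReal_mono hsub).trans ((measureReal_union_le _ _).trans ?_)
  refine (add_le_add (hf.measureReal_compl_regularSet_le hm hd0 hd1)
    (hq.measureReal_avg_le hρ0)).trans ?_
  have e1 : A n / (2 ^ n * m n * d ^ 2) = 1 / d ^ 2 * (a n / 2 ^ n * (A n / (a n * m n))) := by
    field_simp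
  have e2 : 1 * q n / (2 ^ n * ρ ^ 2) =
      16 * (T + 1) ^ 2 / r ^ 2 * (a n / 2 ^ n * (a n * q n)) := by
    rw [hρ]; field_simp; ring
  have e3 : 2 * (n : ℝ) ^ 2 / 2 ^ n = 2 * (n ^ 2 / 2 ^ n) := by ring
  rw [e1, e2, e3]
  have p1 : 0 ≤ a n / 2 ^ n * (A n / (a n * m n)) := by positivity
  have p2 : 0 ≤ a n / 2 ^ n * (a n * q n) := by have := hq.mean_nonneg; positivity
  have p3 : 0 ≤ (n : ℝ) ^ 2 / 2 ^ n := by positivity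
  have p4 : 0 ≤ 1 / d ^ 2 := by positivity
  have p5 : 0 ≤ 16 * (T + 1) ^ 2 / r ^ 2 := by positivity
  generalize 1 / d ^ 2 = c1 at *
  generalize 16 * (T + 1) ^ 2 / r ^ 2 = c2 at *
  rw [mul_add (a n / 2 ^ n)]
  generalize a n / 2 ^ n * (A n / (a n * m n)) = y1 at *
  generalize a n / 2 ^ n * (a n * q n) = y2 at *
  generalize (n : ℝ) ^ 2 / 2 ^ n = y3 at *
  nlinarith [mul_nonneg p4 p2, mul_nonneg p4 p3, mul_nonneg p5 p1, mul_nonneg p5 p3]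

lemma exists_centering_deviation_bound {X : (n : ℕ) → ℕ → Ξ → Cube n}
    (hX : ∀ n, 1 ≤ n → IsCubeWalk Q (X n)) {h : (n : ℕ) → Cube n → Ω → ℝ}
    (hf : ∀ᶠ n in atTop, IsBoundedField P (h n) (A n) (m n))
    (ha : Tendsto a atTop atTop) (hD : ∀ᶠ n in atTop, 0 < D n)
    (h1 : Tendsto (fun n => a n * m n / D n) atTop (𝓝 1))
    (h2 : Tendsto (fun n => A n / (a n * m n)) atTop (𝓝 0)) {T η r : ℝ} (hT : 0 < T) (hη : 0 < η)
    (hr : 0 < r) :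
    ∃ C : ℝ, ∀ᶠ n in atTop, P.real {ω | r ≤ deviationProb Q (fun t ξ =>
      (∑ i ∈ Finset.range ⌊a n * t⌋₊, step (fun x => h n x ω) (X n i ξ)) / D n) T η} ≤
      C * (a n / 2 ^ n * (A n / (a n * m n)) + n ^ 2 / 2 ^ n) := by
  obtain ⟨N, hN⟩ := exists_grid_size T hη
  obtain ⟨d, hd0, hd1, hd⟩ : ∃ d : ℝ, 0 < d ∧ d ≤ 1 ∧ d * (16 * (T + 1)) ≤ η := by
    refine ⟨min 1 (η / (16 * (T + 1))), by positivity, min_le_left _ _, ?_⟩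
    rw [← le_div_iff₀ (by positivity)]
    exact min_le_right _ _
  have l2 : Tendsto (fun n => (N + 1) * (T + 1) * (832 / η ^ 2) * (A n / (a n * m n))) atTop
      (𝓝 0) := by
    simpa using h2.const_mul ((N + 1) * (T + 1) * (832 / η ^ 2))
  refine ⟨1 / d ^ 2 + 2, ?_⟩
  filter_upwards [hf, hD, eventually_ratio_bounds ha hD h1 T hη, eventually_ge_atTop 1,
    l2.eventually (gt_mem_nhds hr)] with n hf hD ⟨ha1, hm, hr2, hr3⟩ hn l2
  have hA : 0 < A n := hm.trans_le hf.mean_le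
  have ha0 : 0 < a n := by linarith
  have hsub : {ω | r ≤ deviationProb Q (fun t ξ =>
      (∑ i ∈ Finset.range ⌊a n * t⌋₊, step (fun x => h n x ω) (X n i ξ)) / D n) T η} ⊆
      (regularSet (h n) (A n) (m n) d)ᶜ := by
    intro ω hω hc
    obtain ⟨c1, c2⟩ := hc
    have key := (hX n hn).deviationProb_centering_le (h := fun x => h n x ω) ha0.le hD hT hη hN
      (fun x => hf.nonneg x ω) fun t ht => abs_mul_avg_div_sub_le ha1 hm.le hD ht
        (abs_floor_sub_le (mul_nonneg ha0.le ht.1)) (by positivity) c1 hr2 hd0.le hd hr3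
    refine absurd (le_trans hω key) (not_le.2 ?_)
    have haT : a n * T + 1 ≤ a n * (T + 1) := by linarith
    calc _ ≤ (N + 1) * (a n * (T + 1) * (13 * A n * m n / (η * D n / 4) ^ 2)) := by
          have := energy_nonneg fun x => h n x ω
          gcongr
      _ = (N + 1) * (T + 1) * (208 / η ^ 2) * (A n / (a n * m n)) * (a n * m n / D n) ^ 2 := by
          field_simp
          ring
      _ ≤ (N + 1) * (T + 1) * (208 / η ^ 2) * (A n / (a n * m n)) * 2 ^ 2 := by
          gcongr
      _ = (N + 1) * (T + 1) * (832 / η ^ 2) * (A n / (a n * m n)) := by ring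
      _ < r := l2
  refine (measureReal_mono hsub).trans ((hf.measureReal_compl_regularSet_le hm hd0 hd1).trans ?_)
  have e1 : A n / (2 ^ n * m n * d ^ 2) = 1 / d ^ 2 * (a n / 2 ^ n * (A n / (a n * m n))) := by
    field_simp
  have e3 : 2 * (n : ℝ) ^ 2 / 2 ^ n = 2 * (n ^ 2 / 2 ^ n) := by ring
  rw [e1, e3]
  have p1 : 0 ≤ a n / 2 ^ n * (A n / (a n * m n)) := by positivity
  have p3 : 0 ≤ (n : ℝ) ^ 2 / 2 ^ n := by positivity
  have p4 : 0 ≤ 1 / d ^ 2 := by positivity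
  nlinarith [mul_nonneg p4 p3]

end Asymptotics

section Elementary

lemma exp_neg_exp_le {p u : ℝ} (hp : 0 ≤ p) (hp2 : p ≤ 2) :
    Real.exp (-Real.exp u) ≤ Real.exp (-(p * u)) := by
  rw [Real.exp_le_exp, neg_le_neg_iff]
  rcases le_total u 0 with hu | hu
  · exact (mul_nonpos_of_nonneg_of_nonpos hp hu).trans (Real.exp_pos u).le
  · have h1 := Real.add_one_le_exp (u - 1)
    have h2 : Real.exp u = Real.exp (u - 1) * Real.exp 1 := by rw [← Real.exp_add]; ring_nf
    have h3 : 2 ≤ Real.exp 1 := by linarith [Real.add_one_le_exp (1 : ℝ)]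
    rw [h2]
    nlinarith

lemma overshoot_exp (b y : ℝ) :
    overshoot (Real.exp b) (Real.exp y) = Real.exp (-Real.exp (b - y)) := by
  rw [overshoot, Real.exp_sub, neg_div]

lemma overshoot_exp_le {p : ℝ} (hp : 0 ≤ p) (hp2 : p ≤ 2) (b y : ℝ) :
    overshoot (Real.exp b) (Real.exp y) ≤ Real.exp (-(p * b)) * Real.exp (p * y) := by
  rw [overshoot_exp, ← Real.exp_add]
  exact (exp_neg_exp_le hp hp2).trans (le_of_eq (by ring_nf))

lemma overshoot_nonneg (A z : ℝ) : 0 ≤ overshoot A z := (Real.exp_pos _).le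

lemma overshoot_le_one {A z : ℝ} (hA : 0 ≤ A) (hz : 0 < z) : overshoot A z ≤ 1 := by
  rw [overshoot, Real.exp_le_one_iff, neg_div, neg_nonpos]
  positivity

lemma cutMean_eq (A z : ℝ) : cutMean A z = z - z * overshoot A z := by
  rw [cutMean, overshoot]; ring

lemma cutMean_mono {A B z : ℝ} (hAB : A ≤ B) (hz : 0 < z) : cutMean A z ≤ cutMean B z := by
  unfold cutMean
  gcongr

lemma cutMean_le_cutMean_one_add {A z : ℝ} (hz : 0 < z) :
    cutMean A z ≤ cutMean 1 z + (A - 1) * overshoot 1 z := by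
  obtain ⟨w, hw⟩ : ∃ w, A - 1 = z * w := ⟨(A - 1) / z, by field_simp⟩
  have h1 : overshoot A z = overshoot 1 z * Real.exp (-w) := by
    rw [overshoot, overshoot, ← Real.exp_add, eq_add_of_sub_eq' hw]
    congr 1
    field_simp
    ring
  have h2 : 1 - w ≤ Real.exp (-w) := Real.one_sub_le_exp_neg _
  rw [cutMean_eq, cutMean_eq, h1, hw]
  nlinarith [mul_le_mul_of_nonneg_left h2 (mul_nonneg hz.le (overshoot_nonneg 1 z))]

lemma half_exp_le_cutMean_one {y : ℝ} (hy : y ≤ 0) :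
    1 / 2 * Real.exp y ≤ cutMean 1 (Real.exp y) := by
  rw [cutMean, mul_comm]
  gcongr
  have h1 : Real.exp (-1 / Real.exp y) ≤ Real.exp (-1) := by
    rw [Real.exp_le_exp, neg_div, neg_le_neg_iff, le_div_iff₀ (Real.exp_pos y), one_mul]
    exact Real.exp_le_one_iff.2 hy
  have h2 : Real.exp (-1) ≤ 1 / 2 := by
    rw [Real.exp_neg, one_div]
    gcongr
    linarith [Real.add_one_le_exp (1 : ℝ)]
  linarith

lemma measurable_cutMean_exp (A : ℝ) : Measurable fun y => cutMean A (Real.exp y) := by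
  unfold cutMean; fun_prop

lemma measurable_overshoot_exp (A : ℝ) : Measurable fun y => overshoot A (Real.exp y) := by
  unfold overshoot; fun_prop

end Elementary

section Gaussian

variable {b : ℝ} {v : NNReal}

lemma integrable_cutMean_exp {A : ℝ} (hA : 0 ≤ A) :
    Integrable (fun y => cutMean A (Real.exp y)) (gaussianReal b v) :=
  Integrable.of_bound (measurable_cutMean_exp A).aestronglyMeasurable A (ae_of_all _ fun y => by
    rw [Real.norm_eq_abs, abs_of_nonneg (cutMean_nonneg hA (Real.exp_pos y))]
    exact cutMean_le hA (Real.exp_pos y))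

lemma integrable_overshoot_exp {A : ℝ} (hA : 0 ≤ A) :
    Integrable (fun y => overshoot A (Real.exp y)) (gaussianReal b v) :=
  Integrable.of_bound (measurable_overshoot_exp A).aestronglyMeasurable 1 (ae_of_all _ fun y => by
    rw [Real.norm_eq_abs, abs_of_nonneg (overshoot_nonneg _ _)]
    exact overshoot_le_one hA (Real.exp_pos y))

lemma integral_exp_mul_gaussianReal (t : ℝ) :
    ∫ y, Real.exp (t * y) ∂(gaussianReal b v) = Real.exp (b * t + v * t ^ 2 / 2) :=
  congrFun mgf_fun_id_gaussianReal t

lemma integral_overshoot_exp_le {p : ℝ} (hp : 0 ≤ p) (hp2 : p ≤ 2) (w : ℝ) :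
    ∫ y, overshoot (Real.exp w) (Real.exp y) ∂(gaussianReal b v) ≤
      Real.exp (-(p * w) + (b * p + v * p ^ 2 / 2)) := by
  rw [Real.exp_add, ← integral_exp_mul_gaussianReal, ← integral_const_mul]
  exact integral_mono (integrable_overshoot_exp (Real.exp_pos w).le)
    ((integrable_exp_mul_gaussianReal p).const_mul _) fun y => overshoot_exp_le hp hp2 w y

lemma integral_exp_sub_integral_cutMean_exp_le {s : ℝ} (hs : 0 ≤ s) (hs2 : s ≤ 2) (w : ℝ) :
    Real.exp (b + v / 2) - ∫ y, cutMean (Real.exp w) (Real.exp y) ∂(gaussianReal b v) ≤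
      Real.exp (-(s * w) + (b * (1 + s) + v * (1 + s) ^ 2 / 2)) := by
  have h1 : Real.exp (b + v / 2) = ∫ y, Real.exp (1 * y) ∂(gaussianReal b v) := by
    rw [integral_exp_mul_gaussianReal]; ring_nf
  rw [h1, ← integral_sub (integrable_exp_mul_gaussianReal 1)
    (integrable_cutMean_exp (Real.exp_pos w).le), Real.exp_add, ← integral_exp_mul_gaussianReal,
    ← integral_const_mul]
  refine integral_mono ((integrable_exp_mul_gaussianReal 1).sub
    (integrable_cutMean_exp (Real.exp_pos w).le))
    ((integrable_exp_mul_gaussianReal (1 + s)).const_mul _) fun y => ?_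
  simp only [cutMean_eq, one_mul, sub_sub_cancel, add_mul, Real.exp_add]
  calc Real.exp y * overshoot (Real.exp w) (Real.exp y)
      ≤ Real.exp y * (Real.exp (-(s * w)) * Real.exp (s * y)) := by
        gcongr; exact overshoot_exp_le hs hs2 w y
    _ = _ := by ring

lemma integral_cutMean_exp_le {A : ℝ} (hA : 0 ≤ A) :
    ∫ y, cutMean A (Real.exp y) ∂(gaussianReal b v) ≤ Real.exp (b + v / 2) := by
  have h1 : Real.exp (b + v / 2) = ∫ y, Real.exp (1 * y) ∂(gaussianReal b v) := by
    rw [integral_exp_mul_gaussianReal]; ring_nf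
  rw [h1]
  refine integral_mono (integrable_cutMean_exp hA) (integrable_exp_mul_gaussianReal 1) fun y => ?_
  simp only [cutMean_eq, one_mul]
  linarith [mul_nonneg (Real.exp_pos y).le (overshoot_nonneg A (Real.exp y))]

/-- The density at the origin of the Gaussian law of mean `-(κ v)` and variance `v`. -/
noncomputable def peak (κ : ℝ) (v : NNReal) : ℝ := gaussianPDFReal (-(κ * v)) v 0

variable {κ : ℝ}

lemma peak_pos (hv : v ≠ 0) : 0 < peak κ v := gaussianPDFReal_pos _ _ _ hv

lemma gaussianPDFReal_eq_peak (hv : v ≠ 0) (y : ℝ) :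
    gaussianPDFReal (-(κ * v)) v y = peak κ v * Real.exp (-(κ * y) - y ^ 2 / (2 * v)) := by
  have hv' : (v : ℝ) ≠ 0 := by exact_mod_cast hv
  rw [peak, gaussianPDFReal, gaussianPDFReal, mul_assoc (√(2 * Real.pi * v))⁻¹, ← Real.exp_add]
  congr 2
  field_simp
  ring

lemma gaussianReal_real_Ici (hv : v ≠ 0) (s : Set ℝ) :
    (gaussianReal b v).real s = ∫ y in s, gaussianPDFReal b v y := by
  rw [measureReal_def, gaussianReal_apply_eq_integral _ hv, ENNReal.toReal_ofReal]
  exact integral_nonneg fun y => gaussianPDFReal_nonneg _ _ _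

lemma peak_mul_exp_le_tail (hv : v ≠ 0) (hκ : 0 ≤ κ) :
    peak κ v * Real.exp (-κ - 1 / (2 * v)) ≤ (gaussianReal (-(κ * v)) v).real (Set.Ici 0) := by
  rw [gaussianReal_real_Ici hv]
  calc _ = ∫ _ in Set.Icc (0 : ℝ) 1, peak κ v * Real.exp (-κ - 1 / (2 * v)) := by simp
    _ ≤ ∫ y in Set.Icc (0 : ℝ) 1, gaussianPDFReal (-(κ * v)) v y := by
        refine setIntegral_mono_on (integrable_const _) (integrable_gaussianPDFReal _ _).integrableOn
          measurableSet_Icc fun y hy => ?_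
        rw [gaussianPDFReal_eq_peak hv]
        have := (peak_pos (κ := κ) hv).le
        have h1 : κ * y ≤ κ := mul_le_of_le_one_right hκ hy.2
        have h2 : y ^ 2 / (2 * (v : ℝ)) ≤ 1 / (2 * v) := by
          have := pow_le_one₀ (n := 2) hy.1 hy.2
          gcongr
        gcongr
    _ ≤ _ := setIntegral_mono_set (integrable_gaussianPDFReal _ _).integrableOn
        (ae_of_all _ fun y => gaussianPDFReal_nonneg _ _ _)
        (LE.le.eventuallyLE Set.Icc_subset_Ici_self)

lemma tail_le_peak_div (hv : v ≠ 0) (hκ : 0 < κ) :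
    (gaussianReal (-(κ * v)) v).real (Set.Ici 0) ≤ peak κ v / κ := by
  have hi : IntegrableOn (fun y => peak κ v * Real.exp (-κ * y)) (Set.Ioi 0) :=
    (integrableOn_exp_mul_Ioi (by linarith) 0).const_mul _
  rw [gaussianReal_real_Ici hv, integral_Ici_eq_integral_Ioi]
  calc _ ≤ ∫ y in Set.Ioi (0 : ℝ), peak κ v * Real.exp (-κ * y) := by
        refine setIntegral_mono_on (integrable_gaussianPDFReal _ _).integrableOn hi
          measurableSet_Ioi fun y _ => ?_
        rw [gaussianPDFReal_eq_peak hv]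
        have := (peak_pos (κ := κ) hv).le
        gcongr
        have : 0 ≤ y ^ 2 / (2 * (v : ℝ)) := by positivity
        linarith
    _ = _ := by
        rw [integral_const_mul, integral_exp_mul_Ioi (by linarith)]
        simp
        field_simp

lemma tail_le_exp (hκ : 0 ≤ κ) :
    (gaussianReal (-(κ * v)) v).real (Set.Ici 0) ≤ Real.exp (-(κ ^ 2 * v / 2)) := by
  have := measure_ge_le_exp_mul_mgf (μ := gaussianReal (-(κ * v)) v) (X := fun y => y) 0 hκ
    (integrable_exp_mul_gaussianReal κ)
  rw [mgf_fun_id_gaussianReal] at this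
  refine this.trans (le_of_eq ?_)
  simp only [mul_zero, Real.exp_zero, one_mul]
  congr 1
  ring

lemma integrable_exp_neg_abs_div : Integrable fun y : ℝ => Real.exp (-(|y| / 4)) := by
  rw [← integrableOn_univ, ← Set.Iic_union_Ioi (a := (0 : ℝ))]
  refine IntegrableOn.union ?_ ?_
  · refine (integrableOn_exp_mul_Iic (by norm_num : (0 : ℝ) < 1 / 4) 0).congr_fun (fun y hy => ?_)
      measurableSet_Iic
    simp only
    rw [abs_of_nonpos hy]
    ring_nf
  · refine (integrableOn_exp_mul_Ioi (by norm_num : (-1 / 4 : ℝ) < 0) 0).congr_fun (fun y hy => ?_)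
      measurableSet_Ioi
    simp only
    rw [abs_of_pos hy]
    ring_nf

lemma integral_overshoot_le_peak (hv : v ≠ 0) (hκ1 : 3 / 4 ≤ κ) (hκ2 : κ ≤ 7 / 4) {s : ℝ}
    (hs : 1 ≤ s) :
    ∫ y, overshoot (s ^ 2) (Real.exp y) ∂(gaussianReal (-(κ * v)) v) ≤
      peak κ v / s * ∫ y : ℝ, Real.exp (-(|y| / 4)) := by
  have hs0 : 0 < s := by linarith
  rw [integral_gaussianReal_eq_integral_smul hv, ← integral_const_mul]
  refine integral_mono_of_nonneg (ae_of_all _ fun y => ?_)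
    (integrable_exp_neg_abs_div.const_mul _) (ae_of_all _ fun y => ?_)
  · exact mul_nonneg (gaussianPDFReal_nonneg _ _ _) (overshoot_nonneg _ _)
  obtain ⟨w, hw, rfl⟩ : ∃ w, 0 ≤ w ∧ s = Real.exp w :=
    ⟨Real.log s, Real.log_nonneg hs, (Real.exp_log hs0).symm⟩
  have hsq : Real.exp w ^ 2 = Real.exp (2 * w) := by rw [← Real.exp_nat_mul]; norm_num
  simp only [smul_eq_mul, gaussianPDFReal_eq_peak hv, hsq]
  have hp := (peak_pos (κ := κ) hv).le
  have hy2 : 0 ≤ y ^ 2 / (2 * (v : ℝ)) := by positivity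
  rw [div_mul_eq_mul_div, mul_assoc, mul_div_assoc]
  refine mul_le_mul_of_nonneg_left ?_ hp
  rw [← Real.exp_sub]
  rcases le_total 0 y with hy | hy
  · calc _ ≤ Real.exp (-(κ * y) - y ^ 2 / (2 * v)) *
          (Real.exp (-(1 / 2 * (2 * w))) * Real.exp (1 / 2 * y)) := by
          gcongr; exact overshoot_exp_le (by norm_num) (by norm_num) _ _
      _ ≤ _ := by
          rw [← Real.exp_add, ← Real.exp_add, Real.exp_le_exp, abs_of_nonneg hy]
          nlinarith
  · calc _ ≤ Real.exp (-(κ * y) - y ^ 2 / (2 * v)) *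
          (Real.exp (-(2 * (2 * w))) * Real.exp (2 * y)) := by
          gcongr; exact overshoot_exp_le (by norm_num) (by norm_num) _ _
      _ ≤ _ := by
          rw [← Real.exp_add, ← Real.exp_add, Real.exp_le_exp, abs_of_nonpos hy]
          nlinarith

lemma le_integral_cutMean_one (hv : v ≠ 0) {K : ℝ} (hK : 0 ≤ K) :
    peak κ v * (K / 2 * Real.exp (-(K * |1 - κ|) - K ^ 2 / (2 * v))) ≤
      ∫ y, cutMean 1 (Real.exp y) ∂(gaussianReal (-(κ * v)) v) := by
  have h0 : ∀ y, 0 ≤ gaussianPDFReal (-(κ * v)) v y * cutMean 1 (Real.exp y) := fun y =>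
    mul_nonneg (gaussianPDFReal_nonneg _ _ _) (cutMean_nonneg zero_le_one (Real.exp_pos y))
  have hi' : Integrable fun y => gaussianPDFReal (-(κ * v)) v y * cutMean 1 (Real.exp y) := by
    refine Integrable.mono' (integrable_gaussianPDFReal (-(κ * v)) v)
      ((measurable_gaussianPDFReal _ _).mul (measurable_cutMean_exp 1)).aestronglyMeasurable
      (ae_of_all _ fun y => ?_)
    rw [Real.norm_eq_abs, abs_of_nonneg (h0 y)]
    exact mul_le_of_le_one_right (gaussianPDFReal_nonneg _ _ _)
      (cutMean_le zero_le_one (Real.exp_pos y))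
  rw [integral_gaussianReal_eq_integral_smul hv]
  simp only [smul_eq_mul]
  calc _ = ∫ _ in Set.Icc (-K) 0, peak κ v *
          (1 / 2 * Real.exp (-(K * |1 - κ|) - K ^ 2 / (2 * v))) := by
        rw [setIntegral_const, measureReal_def, Real.volume_Icc, ENNReal.toReal_ofReal (by linarith)]
        simp only [smul_eq_mul]
        ring
    _ ≤ ∫ y in Set.Icc (-K) 0, gaussianPDFReal (-(κ * v)) v y * cutMean 1 (Real.exp y) := by
        refine setIntegral_mono_on (integrable_const _) hi'.integrableOn
          measurableSet_Icc fun y hy => ?_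
        rw [gaussianPDFReal_eq_peak hv, mul_assoc]
        refine mul_le_mul_of_nonneg_left ?_ (peak_pos hv).le
        calc 1 / 2 * Real.exp (-(K * |1 - κ|) - K ^ 2 / (2 * v))
            ≤ 1 / 2 * Real.exp (-(κ * y) - y ^ 2 / (2 * v) + y) := by
              have h1 : y ^ 2 / (2 * (v : ℝ)) ≤ K ^ 2 / (2 * v) := by
                have : y ^ 2 ≤ K ^ 2 := by nlinarith [hy.1, hy.2]
                gcongr
              have h2 : -(K * |1 - κ|) ≤ y * (1 - κ) := by
                have : |y * (1 - κ)| ≤ K * |1 - κ| := by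
                  rw [abs_mul]
                  gcongr
                  rw [abs_le]
                  exact ⟨hy.1, hy.2.trans hK⟩
                linarith [neg_abs_le (y * (1 - κ))]
              gcongr
              linarith
          _ = Real.exp (-(κ * y) - y ^ 2 / (2 * v)) * (1 / 2 * Real.exp y) := by
              rw [Real.exp_add]; ring
          _ ≤ _ := by
              gcongr
              exact half_exp_le_cutMean_one hy.2
    _ ≤ _ := setIntegral_le_integral hi' (ae_of_all _ h0)

end Gaussian

section Scale

/-- The total variance `β² n` of the logarithm of the landscape. -/
noncomputable def logVar (β : ℝ) (n : ℕ) : NNReal := .mk (β ^ 2) (sq_nonneg β) * n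

lemma coe_logVar (β : ℝ) (n : ℕ) : (logVar β n : ℝ) = β ^ 2 * n := by simp [logVar]

lemma logVar_ne_zero {β : ℝ} (hβ : 0 < β) {n : ℕ} (hn : 1 ≤ n) : logVar β n ≠ 0 := by
  rw [← NNReal.coe_ne_zero, coe_logVar]
  positivity

lemma tendsto_logVar {β : ℝ} (hβ : 0 < β) :
    Tendsto (fun n => (logVar β n : ℝ)) atTop atTop := by
  simp_rw [coe_logVar]
  exact tendsto_natCast_atTop_atTop.const_mul_atTop (by positivity)

variable {Ω : Type*} [MeasurableSpace Ω] {P : Measure Ω} {H : (n : ℕ) → Cube n → Ω → ℝ} {β : ℝ}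

lemma IsHamiltonian.hasLaw_log (hH : IsHamiltonian P H) {n : ℕ} (hn : 1 ≤ n) (b : ℝ) (x : Cube n) :
    HasLaw (fun ω => -β * H n x ω + b) (gaussianReal b (logVar β n)) P := by
  have h1 := gaussianReal_add_const (gaussianReal_const_mul (hH.law n hn x) (-β)) b
  convert h1 using 2
  · simp
  · simp [logVar]

lemma IsHamiltonian.isBoundedField (hH : IsHamiltonian P H) {n : ℕ} (hn : 1 ≤ n) (b : ℝ)
    {f : ℝ → ℝ} (hf : Measurable f) {A : ℝ} (h0 : ∀ y, 0 ≤ f y) (hA : ∀ y, f y ≤ A) :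
    IsBoundedField P (fun (x : Cube n) ω => f (-β * H n x ω + b)) A
      (∫ y, f y ∂(gaussianReal b (logVar β n))) where
  aemeasurable x := hf.comp_aemeasurable (hH.hasLaw_log hn b x).aemeasurable
  indep := (hH.indep n hn).comp (fun _ h => f (-β * h + b)) fun _ =>
    hf.comp ((measurable_id.const_mul (-β)).add_const b)
  nonneg _ _ := h0 _
  le _ _ := hA _
  mean x := (hH.hasLaw_log hn b x).integral_comp hf.aestronglyMeasurable

lemma IsHamiltonian.mul_tail_eq_one (hH : IsHamiltonian P H) {a c : ℕ → ℝ}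
    (ha : IsAuxScale P H β a c) {n : ℕ} (hn : 1 ≤ n) (hc : 0 < c n) :
    a n * (gaussianReal (-Real.log (c n)) (logVar β n)).real (Set.Ici 0) = 1 := by
  rw [← ha n hn fun _ => 1]
  congr 1
  rw [← Set.Ici_def, ← (hH.hasLaw_log (β := β) hn (-Real.log (c n)) fun _ => 1).measureReal_eq
    (p := fun y => 0 ≤ y) measurableSet_Ici]
  congr 1
  ext ω
  simp only [Set.mem_ofPred_eq, boltzmann]
  rw [← Real.log_le_iff_le_exp hc]
  constructor <;> intro h <;> linarith

lemma IsIntermediateTimeScale.tendsto_atTop {ε : ℝ} {a c : ℕ → ℝ}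
    (hc : IsIntermediateTimeScale ε a c) (ha : ∀ᶠ n in atTop, 0 < a n) :
    Tendsto a atTop atTop := by
  have h1 : Tendsto (fun n : ℕ => (n : ℝ) * Real.log 2) atTop atTop :=
    tendsto_natCast_atTop_atTop.atTop_mul_const (Real.log_pos one_lt_two)
  have h2 := hc.log_limit.pos_mul_atTop hc.pos h1
  refine (Real.tendsto_exp_atTop.comp h2).congr' ?_
  filter_upwards [ha, eventually_ge_atTop 1] with n hn hn1
  have : (n : ℝ) * Real.log 2 ≠ 0 := by
    have := Real.log_pos one_lt_two
    positivity
  simp only [Function.comp_apply, div_mul_cancel₀ _ this]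
  exact Real.exp_log hn

end Scale

section Critical

variable {κ a : ℕ → ℝ} {v : ℕ → NNReal}

/-- The exponent `κ` is determined by the growth of `a`. -/
lemma tendsto_sq_exponent (hv0 : ∀ᶠ n in atTop, v n ≠ 0)
    (hv : Tendsto (fun n => (v n : ℝ)) atTop atTop) (hκ : ∀ᶠ n in atTop, 0 ≤ κ n)
    (ha : ∀ᶠ n in atTop, a n * (gaussianReal (-(κ n * v n)) (v n)).real (Set.Ici 0) = 1) {l : ℝ}
    (hl : Tendsto (fun n => 2 * Real.log (a n) / v n) atTop (𝓝 l)) :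
    Tendsto (fun n => κ n ^ 2) atTop (𝓝 l) := by
  let r : ℕ → ℝ := fun n => 2 * (1 + 2 * Real.log (a n) / v n) / v n + (1 / v n) / v n +
    (Real.log (2 * Real.pi) / v n + Real.log (v n) / v n)
  have hr : Tendsto r atTop (𝓝 0) := by
    have t1 : Tendsto (fun n => 2 * (1 + 2 * Real.log (a n) / v n) / v n) atTop (𝓝 0) :=
      ((hl.const_add 1).const_mul 2).div_atTop hv
    have t2 : Tendsto (fun n => (1 / v n : ℝ) / v n) atTop (𝓝 0) :=
      (tendsto_const_nhds.div_atTop hv).div_atTop hv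
    have t3 : Tendsto (fun n => Real.log (2 * Real.pi) / (v n : ℝ)) atTop (𝓝 0) :=
      tendsto_const_nhds.div_atTop hv
    have t4 : Tendsto (fun n => Real.log (v n) / (v n : ℝ)) atTop (𝓝 0) :=
      Real.isLittleO_log_id_atTop.tendsto_div_nhds_zero.comp hv
    have := (t1.add t2).add (t3.add t4)
    simp only [add_zero] at this
    exact this
  refine tendsto_of_tendsto_of_tendsto_of_le_of_le' (by simpa using hl.sub hr) hl ?_ ?_
  all_goals
    filter_upwards [hv0, hκ, ha] with n hv0 hκ ha
    have hvp : (0 : ℝ) < v n := by positivity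
    set w := (gaussianReal (-(κ n * v n)) (v n)).real (Set.Ici 0)
    have hw : 0 < w := by
      rcases (measureReal_nonneg : 0 ≤ w).eq_or_lt with h | h
      · have h' : w = 0 := h.symm
        rw [h'] at ha; simp at ha
      · exact h
    have hlog : Real.log (a n) = -Real.log w := by
      rw [eq_div_of_mul_eq hw.ne' ha, one_div, Real.log_inv]
    have hup : κ n ^ 2 ≤ 2 * Real.log (a n) / v n := by
      have := Real.log_le_log hw (tail_le_exp (v := v n) hκ)
      rw [Real.log_exp] at this
      rw [le_div_iff₀ hvp]
      linarith
  · have hlow := Real.log_le_log (mul_pos (peak_pos hv0) (Real.exp_pos _))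
      (peak_mul_exp_le_tail hv0 hκ)
    rw [Real.log_mul (peak_pos hv0).ne' (Real.exp_pos _).ne', Real.log_exp, peak, gaussianPDFReal,
      Real.log_mul (by positivity) (Real.exp_pos _).ne', Real.log_exp, Real.log_inv,
      Real.log_sqrt (by positivity), Real.log_mul (by positivity) hvp.ne'] at hlow
    have e1 : -(0 - -(κ n * (v n : ℝ))) ^ 2 / (2 * v n) = -(κ n ^ 2 * v n / 2) := by
      field_simp
      ring
    rw [e1] at hlow
    have hk : κ n ≤ 1 + 2 * Real.log (a n) / v n := by nlinarith
    have e2 : (2 * Real.log (a n) / v n - r n) * v n = 2 * Real.log (a n) -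
        (2 * (1 + 2 * Real.log (a n) / v n) + 1 / v n +
          (Real.log (2 * Real.pi) + Real.log (v n))) := by
      simp only [r]
      field_simp
    refine le_of_mul_le_mul_right ?_ hvp
    rw [e2]
    have e3 : 1 / (2 * (v n : ℝ)) = 1 / v n / 2 := by field_simp
    rw [e3] at hlow
    linarith
  · exact hup

/-- The mean of the centering of one visit. -/
noncomputable def cutMeanOne (κ : ℝ) (v : NNReal) : ℝ :=
  ∫ y, cutMean 1 (Real.exp y) ∂(gaussianReal (-(κ * v)) v)

lemma eventually_mul_peak (hv0 : ∀ᶠ n in atTop, v n ≠ 0)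
    (hv : Tendsto (fun n => (v n : ℝ)) atTop atTop) (hκ : Tendsto κ atTop (𝓝 1))
    (ha : ∀ᶠ n in atTop, a n * (gaussianReal (-(κ n * v n)) (v n)).real (Set.Ici 0) = 1) :
    ∀ᶠ n in atTop, 0 < a n ∧ 1 / 2 ≤ a n * peak (κ n) (v n) ∧
      a n * peak (κ n) (v n) ≤ Real.exp 3 := by
  filter_upwards [hv0, hv.eventually_ge_atTop 1, ha,
    hκ.eventually (lt_mem_nhds (by norm_num : (1 / 2 : ℝ) < 1)),
    hκ.eventually (gt_mem_nhds (by norm_num : (1 : ℝ) < 2))] with n hv0 hv1 ha h1 h2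
  have ha0 : 0 < a n := by
    rcases lt_or_ge 0 (a n) with h | h
    · exact h
    · have := mul_nonpos_of_nonpos_of_nonneg h (measureReal_nonneg
        (μ := gaussianReal (-(κ n * v n)) (v n)) (s := Set.Ici 0))
      linarith
  refine ⟨ha0, ?_, ?_⟩
  · have h3 := mul_le_mul_of_nonneg_left (tail_le_peak_div hv0 (by linarith : 0 < κ n)) ha0.le
    rw [ha, mul_div_assoc', le_div_iff₀ (by linarith)] at h3
    linarith
  · have h3 := mul_le_mul_of_nonneg_left (peak_mul_exp_le_tail hv0 (by linarith : 0 ≤ κ n)) ha0.le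
    rw [ha, ← mul_assoc] at h3
    have h4 : 1 / (2 * (v n : ℝ)) ≤ 1 := by
      rw [div_le_one (by linarith)]; linarith
    have h5 : Real.exp (-3) ≤ Real.exp (-κ n - 1 / (2 * v n)) := by
      rw [Real.exp_le_exp]; linarith
    have h6 : a n * peak (κ n) (v n) * Real.exp (-3) ≤ 1 :=
      (mul_le_mul_of_nonneg_left h5 (mul_pos ha0 (peak_pos hv0)).le).trans h3
    rwa [Real.exp_neg, ← div_eq_mul_inv, div_le_one (Real.exp_pos 3)] at h6

lemma tendsto_mul_cutMeanOne (hv0 : ∀ᶠ n in atTop, v n ≠ 0)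
    (hv : Tendsto (fun n => (v n : ℝ)) atTop atTop) (hκ : Tendsto κ atTop (𝓝 1))
    (ha : ∀ᶠ n in atTop, a n * (gaussianReal (-(κ n * v n)) (v n)).real (Set.Ici 0) = 1) :
    Tendsto (fun n => a n * cutMeanOne (κ n) (v n)) atTop atTop := by
  rw [tendsto_atTop]
  intro B
  set K := 8 * |B| with hK
  have hlim : Tendsto (fun n => Real.exp (-(K * |1 - κ n|) - K ^ 2 / (2 * v n))) atTop (𝓝 1) := by
    have t1 : Tendsto (fun n => -(K * |1 - κ n|)) atTop (𝓝 0) := by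
      have := (((hκ.const_sub 1).abs).const_mul K).neg
      simpa using this
    have t2 : Tendsto (fun n => K ^ 2 / (2 * (v n : ℝ))) atTop (𝓝 0) :=
      tendsto_const_nhds.div_atTop (hv.const_mul_atTop two_pos)
    have := (t1.sub t2).rexp
    simpa using this
  filter_upwards [hv0, eventually_mul_peak hv0 hv hκ ha,
    hlim.eventually (lt_mem_nhds (by norm_num : (1 / 2 : ℝ) < 1))] with n hv0 ⟨ha0, h1, _⟩ h2
  calc B ≤ |B| := le_abs_self B
    _ = 1 / 2 * (K / 2 * (1 / 2)) := by rw [hK]; ring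
    _ ≤ a n * peak (κ n) (v n) *
        (K / 2 * Real.exp (-(K * |1 - κ n|) - K ^ 2 / (2 * v n))) := by
        have : 0 ≤ K := by positivity
        gcongr
    _ = a n * (peak (κ n) (v n) *
        (K / 2 * Real.exp (-(K * |1 - κ n|) - K ^ 2 / (2 * v n)))) := by ring
    _ ≤ _ := mul_le_mul_of_nonneg_left (le_integral_cutMean_one hv0 (by positivity)) ha0.le

/-- The square root of the truncation level used at criticality. -/
noncomputable def critLevel (a κ : ℝ) (v : NNReal) : ℝ := √√(a * cutMeanOne κ v)

lemma critical_scale_limits (hv0 : ∀ᶠ n in atTop, v n ≠ 0)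
    (hv : Tendsto (fun n => (v n : ℝ)) atTop atTop) (hκ : Tendsto κ atTop (𝓝 1))
    (ha : ∀ᶠ n in atTop, a n * (gaussianReal (-(κ n * v n)) (v n)).real (Set.Ici 0) = 1)
    (hai : Tendsto a atTop atTop) :
    Tendsto (fun n => a n * cutMeanOne (κ n) (v n) / (⌊a n⌋₊ * cutMeanOne (κ n) (v n))) atTop
      (𝓝 1) ∧
    Tendsto (fun n => a n * (∫ y, cutMean (critLevel (a n) (κ n) (v n) ^ 2) (Real.exp y)
      ∂(gaussianReal (-(κ n * v n)) (v n))) / (⌊a n⌋₊ * cutMeanOne (κ n) (v n))) atTop (𝓝 1) ∧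
    Tendsto (fun n => critLevel (a n) (κ n) (v n) ^ 2 /
      (a n * ∫ y, cutMean (critLevel (a n) (κ n) (v n) ^ 2) (Real.exp y)
        ∂(gaussianReal (-(κ n * v n)) (v n)))) atTop (𝓝 0) ∧
    Tendsto (fun n => a n * ∫ y, overshoot (critLevel (a n) (κ n) (v n) ^ 2) (Real.exp y)
        ∂(gaussianReal (-(κ n * v n)) (v n))) atTop (𝓝 0) := by
  have hm := tendsto_mul_cutMeanOne hv0 hv hκ ha
  set s : ℕ → ℝ := fun n => critLevel (a n) (κ n) (v n) with hs
  have hst : Tendsto s atTop atTop :=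
    Real.tendsto_sqrt_atTop.comp (Real.tendsto_sqrt_atTop.comp hm)
  set I : ℝ := ∫ y : ℝ, Real.exp (-(|y| / 4)) with hI
  have hI0 : 0 ≤ I := integral_nonneg fun y => (Real.exp_pos _).le
  have hq : ∀ᶠ n in atTop, ∀ u : ℝ, 1 ≤ u →
      a n * ∫ y, overshoot (u ^ 2) (Real.exp y) ∂(gaussianReal (-(κ n * v n)) (v n)) ≤
        Real.exp 3 * I / u := by
    filter_upwards [hv0, eventually_mul_peak hv0 hv hκ ha,
      hκ.eventually (le_mem_nhds (by norm_num : (3 / 4 : ℝ) < 1)),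
      hκ.eventually (ge_mem_nhds (by norm_num : (1 : ℝ) < 7 / 4))] with n hv0 ⟨ha0, _, h1⟩ h2 h3 u hu
    have hu0 : 0 < u := by linarith
    calc _ ≤ a n * (peak (κ n) (v n) / u * I) :=
          mul_le_mul_of_nonneg_left (integral_overshoot_le_peak hv0 h2 h3 hu) ha0.le
      _ = a n * peak (κ n) (v n) * I / u := by ring
      _ ≤ _ := by gcongr
  have hgood : ∀ᶠ n in atTop, 0 < a n ∧ 0 < cutMeanOne (κ n) (v n) ∧ 1 ≤ s n ∧
      s n ^ 4 = a n * cutMeanOne (κ n) (v n) ∧ (0 : ℝ) < ⌊a n⌋₊ := by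
    filter_upwards [hai.eventually_ge_atTop 1, hm.eventually_gt_atTop 0,
      hst.eventually_ge_atTop 1] with n h1 h2 h3
    refine ⟨by linarith, pos_of_mul_pos_right h2 (by linarith), h3, ?_, ?_⟩
    · have e : s n ^ 4 = (s n ^ 2) ^ 2 := by ring
      rw [e, hs]
      simp only [critLevel]
      rw [Real.sq_sqrt (Real.sqrt_nonneg _), Real.sq_sqrt h2.le]
    · exact_mod_cast Nat.floor_pos.2 h1
  have hfloor : Tendsto (fun n => a n / (⌊a n⌋₊ : ℝ)) atTop (𝓝 1) := by
    have := (tendsto_nat_floor_div_atTop (R := ℝ)).comp hai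
    have := this.inv₀ one_ne_zero
    simpa [Function.comp_def] using this
  have hcut : ∀ᶠ n in atTop, cutMeanOne (κ n) (v n) ≤
      ∫ y, cutMean (s n ^ 2) (Real.exp y) ∂(gaussianReal (-(κ n * v n)) (v n)) := by
    filter_upwards [hgood] with n ⟨_, _, h3, _, _⟩
    exact integral_mono (integrable_cutMean_exp zero_le_one) (integrable_cutMean_exp (sq_nonneg _))
      fun y => cutMean_mono (one_le_pow₀ h3) (Real.exp_pos y)
  have hcut2 : ∀ᶠ n in atTop,
      a n * ∫ y, cutMean (s n ^ 2) (Real.exp y) ∂(gaussianReal (-(κ n * v n)) (v n)) ≤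
      a n * cutMeanOne (κ n) (v n) + s n ^ 2 * (Real.exp 3 * I) := by
    filter_upwards [hgood, hq] with n ⟨h1, _, h3, _, _⟩ hq
    have i1 := integrable_cutMean_exp (b := -(κ n * v n)) (v := v n) zero_le_one
    have i2 := integrable_overshoot_exp (b := -(κ n * v n)) (v := v n) zero_le_one
    have hle : ∫ y, cutMean (s n ^ 2) (Real.exp y) ∂(gaussianReal (-(κ n * v n)) (v n)) ≤
        cutMeanOne (κ n) (v n) + (s n ^ 2 - 1) *
          ∫ y, overshoot 1 (Real.exp y) ∂(gaussianReal (-(κ n * v n)) (v n)) := by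
      rw [cutMeanOne, ← integral_const_mul, ← integral_add i1 (i2.const_mul _)]
      exact integral_mono (integrable_cutMean_exp (sq_nonneg _)) (i1.add (i2.const_mul _))
        fun y => cutMean_le_cutMean_one_add (Real.exp_pos y)
    have h4 := hq 1 le_rfl
    rw [one_pow, div_one] at h4
    have h5 : 1 ≤ s n ^ 2 := one_le_pow₀ h3
    calc _ ≤ a n * (cutMeanOne (κ n) (v n) + (s n ^ 2 - 1) *
          ∫ y, overshoot 1 (Real.exp y) ∂(gaussianReal (-(κ n * v n)) (v n))) :=
          mul_le_mul_of_nonneg_left hle h1.le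
      _ = a n * cutMeanOne (κ n) (v n) + (s n ^ 2 - 1) *
          (a n * ∫ y, overshoot 1 (Real.exp y) ∂(gaussianReal (-(κ n * v n)) (v n))) := by ring
      _ ≤ a n * cutMeanOne (κ n) (v n) + (s n ^ 2 - 1) * (Real.exp 3 * I) := by
          gcongr
      _ ≤ _ := by
          gcongr; linarith
  refine ⟨?_, ?_, ?_, ?_⟩
  · refine hfloor.congr' ?_
    filter_upwards [hgood] with n ⟨_, h2, _, _, _⟩
    rw [mul_div_mul_right _ _ h2.ne']
  · have hup : Tendsto (fun n => a n / (⌊a n⌋₊ : ℝ) * (1 + Real.exp 3 * I / s n ^ 2)) atTop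
        (𝓝 1) := by
      have t : Tendsto (fun n => Real.exp 3 * I / s n ^ 2) atTop (𝓝 0) :=
        tendsto_const_nhds.div_atTop ((tendsto_pow_atTop two_ne_zero).comp hst)
      simpa using hfloor.mul (t.const_add 1)
    refine tendsto_of_tendsto_of_tendsto_of_le_of_le' hfloor hup ?_ ?_
    · filter_upwards [hgood, hcut] with n ⟨h1, h2, _, _, h5⟩ hc
      rw [div_le_div_iff₀ h5 (mul_pos h5 h2)]
      have := mul_le_mul_of_nonneg_left hc (mul_pos h1 h5).le
      linarith
    · filter_upwards [hgood, hcut2] with n ⟨h1, h2, h3, h4, h5⟩ hc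
      have hs0 : 0 < s n := by linarith
      rw [div_le_iff₀ (mul_pos h5 h2)]
      refine hc.trans (le_of_eq ?_)
      calc _ = a n * cutMeanOne (κ n) (v n) + s n ^ 4 * (Real.exp 3 * I) / s n ^ 2 := by
            field_simp
        _ = _ := by
            rw [h4]
            field_simp
  · have t : Tendsto (fun n => 1 / s n ^ 2) atTop (𝓝 0) :=
      tendsto_const_nhds.div_atTop ((tendsto_pow_atTop two_ne_zero).comp hst)
    refine squeeze_zero' ?_ ?_ t
    · filter_upwards [hgood, hcut] with n ⟨h1, h2, h3, _, _⟩ hc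
      have := h2.trans_le hc
      positivity
    · filter_upwards [hgood, hcut] with n ⟨h1, h2, h3, h4, _⟩ hc
      have hs0 : 0 < s n := by linarith
      have h6 := mul_le_mul_of_nonneg_left hc h1.le
      rw [← h4] at h6
      calc _ ≤ s n ^ 2 / s n ^ 4 := div_le_div_of_nonneg_left (by positivity) (by positivity) h6
        _ = _ := by field_simp
  · have t : Tendsto (fun n => Real.exp 3 * I / s n) atTop (𝓝 0) :=
      tendsto_const_nhds.div_atTop hst
    refine squeeze_zero' ?_ ?_ t
    · filter_upwards [hgood] with n ⟨h1, _, _, _, _⟩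
      exact mul_nonneg h1.le (integral_nonneg fun y => overshoot_nonneg _ _)
    · filter_upwards [hgood, hq] with n ⟨_, _, h3, _, _⟩ hq
      exact hq (s n) h3

end Critical

section Subcritical

/-- Truncation levels that are exponentially smaller than `a n` but large enough for the truncated
mean of the normalized landscape to converge, when `a n` grows at rate `r > β ^ 2 / 2`. -/
lemma exists_truncation_rate {β r : ℝ} (hβ : 0 < β) (hr : β ^ 2 / 2 < r) {a : ℕ → ℝ}
    (ha0 : ∀ᶠ n in atTop, 0 < a n)
    (ha : Tendsto (fun n : ℕ => Real.log (a n) / n) atTop (𝓝 r)) :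
    ∃ w d : ℝ, 0 < d ∧ ∀ᶠ n : ℕ in atTop,
      Real.exp (n * w) / a n ≤ Real.exp (-(d * n)) ∧
      1 - Real.exp (-(d * n)) ≤ ∫ y, cutMean (Real.exp (n * w)) (Real.exp y)
        ∂(gaussianReal (-(logVar β n / 2)) (logVar β n)) ∧
      a n * ∫ y, overshoot (Real.exp (n * w)) (Real.exp y)
        ∂(gaussianReal (-(logVar β n / 2)) (logVar β n)) ≤ Real.exp (-(d * n)) := by
  obtain ⟨s, hs0, hs1, hs⟩ : ∃ s : ℝ, 0 < s ∧ s ≤ 1 ∧ β ^ 2 * (1 + s) / 2 < r := by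
    refine ⟨min 1 ((r - β ^ 2 / 2) / β ^ 2), ?_, min_le_left _ _, ?_⟩
    · have : 0 < r - β ^ 2 / 2 := by linarith
      positivity
    · have h1 := min_le_right 1 ((r - β ^ 2 / 2) / β ^ 2)
      rw [le_div_iff₀ (by positivity)] at h1
      linarith
  set g := r - β ^ 2 * (1 + s) / 2 with hg
  have hg0 : 0 < g := by linarith
  set d := s * g / 10 with hd
  have hd0 : 0 < d := by positivity
  have hdg : d ≤ g / 10 := by rw [hd]; nlinarith
  refine ⟨r - 2 * d, d, hd0, ?_⟩
  filter_upwards [ha0, eventually_ge_atTop 1, ha.eventually (lt_mem_nhds (by linarith : r - d < r)),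
    ha.eventually (gt_mem_nhds (by linarith : r < r + d))] with n ha0 hn h1 h2
  have hn0 : (0 : ℝ) < n := by exact_mod_cast hn
  rw [lt_div_iff₀ hn0] at h1
  rw [div_lt_iff₀ hn0] at h2
  have hv := coe_logVar β n
  refine ⟨?_, ?_, ?_⟩
  · rw [div_le_iff₀ ha0, ← Real.exp_log ha0, ← Real.exp_add, Real.exp_le_exp]
    linarith
  · have h3 := integral_exp_sub_integral_cutMean_exp_le (b := -(logVar β n / 2)) (v := logVar β n)
      hs0.le (by linarith) (n * (r - 2 * d))
    rw [neg_add_cancel, Real.exp_zero] at h3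
    have h4 : -(s * (n * (r - 2 * d))) + (-((logVar β n : ℝ) / 2) * (1 + s) +
        logVar β n * (1 + s) ^ 2 / 2) ≤ -(d * n) := by
      rw [hv]
      have e : -(s * (n * (r - 2 * d))) + (-(β ^ 2 * (n : ℝ) / 2) * (1 + s) +
        β ^ 2 * n * (1 + s) ^ 2 / 2) = -((s * g - 2 * s * d) * n) := by rw [hg]; ring
      rw [e, neg_le_neg_iff]
      refine mul_le_mul_of_nonneg_right ?_ hn0.le
      have : s * g = 10 * d := by rw [hd]; ring
      nlinarith
    have h5 := Real.exp_le_exp.2 h4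
    linarith
  · have h3 := integral_overshoot_exp_le (b := -(logVar β n / 2)) (v := logVar β n)
      (by linarith : 0 ≤ 1 + s) (by linarith) (n * (r - 2 * d))
    refine (mul_le_mul_of_nonneg_left h3 ha0.le).trans ?_
    rw [← Real.exp_log ha0, ← Real.exp_add, Real.exp_le_exp, hv]
    have e : -((1 + s) * (n * (r - 2 * d))) + (-(β ^ 2 * (n : ℝ) / 2) * (1 + s) +
        β ^ 2 * n * (1 + s) ^ 2 / 2) = -((r + s * g - 2 * (1 + s) * d) * n) := by rw [hg]; ring
    rw [e]
    have : s * g = 10 * d := by rw [hd]; ring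
    have h6 : d * n ≤ (s * g - 2 * (1 + s) * d - d) * n := by
      refine mul_le_mul_of_nonneg_right ?_ hn0.le
      nlinarith
    linarith

end Subcritical

section Sums

variable {Ω Ξ : Type*} {H : (n : ℕ) → Cube n → Ω → ℝ} {J : (n : ℕ) → ℕ → Ξ → Cube n}
  {e : ℕ → ℕ → Ξ → ℝ} {β : ℝ} {a c : ℕ → ℝ}

lemma inv_mul_landscape {n : ℕ} (hc : 0 < c n) (x : Cube n) (ω : Ω) :
    (c n)⁻¹ * landscape H β n ω x = Real.exp (-β * H n x ω + -Real.log (c n)) := by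
  rw [landscape, boltzmann, Real.exp_add, Real.exp_neg (Real.log _), Real.exp_log hc, mul_comm]

lemma S_eq_sum {n : ℕ} (hc : 0 < c n) (ω : Ω) (t : ℝ) (ξ : Ξ) :
    S H J e β a c n ω t ξ = ∑ i ∈ Finset.range (⌊a n * t⌋₊ + 1),
      Real.exp (-β * H n (J n i ξ) ω + -Real.log (c n)) * e n i ξ := by
  rw [S, clock, Finset.mul_sum]
  exact Finset.sum_congr rfl fun i _ => by rw [← mul_assoc, inv_mul_landscape hc]

lemma M_eq_sum {n : ℕ} (hc : 0 < c n) (ω : Ω) (t : ℝ) (ξ : Ξ) :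
    M H J β a c n ω t ξ = ∑ i ∈ Finset.range ⌊a n * t⌋₊,
      step (fun x => cutMean 1 (Real.exp (-β * H n x ω + -Real.log (c n)))) (J n i ξ) := by
  rw [M, centering, ← Finset.Ico_add_one_right_eq_Icc, Finset.sum_Ico_eq_sum_range]
  simp only [Nat.add_sub_cancel, Nat.add_sub_cancel_left, rescaled, inv_mul_landscape hc, step,
    cutMean]

end Sums

section Assembly

variable {Ω Ξ : Type*} [MeasurableSpace Ω] [MeasurableSpace Ξ] {P : Measure Ω} {Q : Measure Ξ}
  {H : (n : ℕ) → Cube n → Ω → ℝ} {J : (n : ℕ) → ℕ → Ξ → Cube n} {e : ℕ → ℕ → Ξ → ℝ}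
  {β : ℝ} {a c : ℕ → ℝ}

lemma IsJumpDynamics.isTimedWalk (hJ : IsJumpDynamics Q J e) {n : ℕ} (hn : 1 ≤ n) :
    IsTimedWalk Q (J n) (e n) where
  walk := ⟨hn, hJ.chain_measurable n hn, hJ.chain_law n hn⟩
  exp_law := hJ.exp_law n hn
  exp_indep := hJ.exp_indep n hn
  indep := hJ.chain_indep_exp n hn

lemma meanM_eq [IsProbabilityMeasure P] [IsProbabilityMeasure Q] (hH : IsHamiltonian P H)
    (hJ : IsJumpDynamics Q J e) {n : ℕ} (hn : 1 ≤ n) (hc : 0 < c n) :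
    meanM P Q H J β a c n = ⌊a n⌋₊ *
      ∫ y, cutMean 1 (Real.exp y) ∂(gaussianReal (-Real.log (c n)) (logVar β n)) := by
  have hX := (hJ.isTimedWalk hn).walk
  have hf := hH.isBoundedField (β := β) hn (-Real.log (c n)) (measurable_cutMean_exp 1)
    (fun y => cutMean_nonneg zero_le_one (Real.exp_pos y))
    (fun y => cutMean_le zero_le_one (Real.exp_pos y))
  have h1 : ∀ ω, ∫ ξ, M H J β a c n ω 1 ξ ∂Q = ⌊a n⌋₊ * avg fun x =>
      cutMean 1 (Real.exp (-β * H n x ω + -Real.log (c n))) := by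
    intro ω
    simp_rw [M_eq_sum hc]
    rw [integral_finsetSum _ fun i _ => integrable_comp_fintype Q (hX.measurable i) _]
    simp_rw [hX.integral_eq_avg, avg_step hn]
    simp
  rw [meanM]
  simp_rw [h1]
  rw [integral_const_mul]
  congr 1
  simp only [avg]
  rw [integral_div, integral_finsetSum _ fun x _ => hf.integrable x]
  simp_rw [hf.mean]
  rw [Finset.sum_const, Finset.card_univ, card_cube, nsmul_eq_mul]
  push_cast
  field_simp

lemma tendsto_sq_div_two_pow : Tendsto (fun n : ℕ => (n : ℝ) ^ 2 / 2 ^ n) atTop (𝓝 0) :=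
  tendsto_pow_const_div_const_pow_of_one_lt 2 one_lt_two

lemma summable_sq_div_two_pow : Summable fun n : ℕ => (n : ℝ) ^ 2 / 2 ^ n := by
  have := summable_pow_mul_geometric_of_norm_lt_one (R := ℝ) 2 (r := 1 / 2) (by norm_num)
  refine this.congr fun n => ?_
  rw [one_div, inv_pow, div_eq_mul_inv]

lemma tendsto_error {x w : ℕ → ℝ} (hx : Tendsto x atTop (𝓝 0)) (hw : Tendsto w atTop (𝓝 0)) :
    Tendsto (fun n => x n * w n + (n : ℝ) ^ 2 / 2 ^ n) atTop (𝓝 0) := by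
  simpa using (hx.mul hw).add tendsto_sq_div_two_pow

lemma summable_error {x w : ℕ → ℝ} (hx : Summable x) (hw : Tendsto w atTop (𝓝 0)) :
    Summable fun n => x n * w n + (n : ℝ) ^ 2 / 2 ^ n := by
  refine Summable.add ?_ summable_sq_div_two_pow
  refine Summable.of_norm_bounded_eventually_nat hx.abs ?_
  have := hw.abs
  rw [abs_zero] at this
  filter_upwards [this.eventually (ge_mem_nhds one_pos)] with n hn
  rw [norm_mul]
  exact mul_le_of_le_one_right (abs_nonneg _) hn

lemma deviationProb_nonneg (Y : ℝ → Ξ → ℝ) (T η : ℝ) : 0 ≤ deviationProb Q Y T η :=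
  measureReal_nonneg

lemma eventually_mul_tail (hH : IsHamiltonian P H) (ha : IsAuxScale P H β a c)
    (hc : Tendsto c atTop atTop) : ∀ᶠ n in atTop,
      a n * (gaussianReal (-Real.log (c n)) (logVar β n)).real (Set.Ici 0) = 1 := by
  filter_upwards [hc.eventually_gt_atTop 0, eventually_ge_atTop 1] with n hc hn
  exact hH.mul_tail_eq_one ha hn hc

lemma eventually_aux_pos (hH : IsHamiltonian P H) (ha : IsAuxScale P H β a c)
    (hc : Tendsto c atTop atTop) : ∀ᶠ n in atTop, 0 < a n := by
  filter_upwards [eventually_mul_tail hH ha hc] with n hn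
  rcases lt_or_ge 0 (a n) with h | h
  · exact h
  · have := mul_nonpos_of_nonpos_of_nonneg h (measureReal_nonneg
      (μ := gaussianReal (-Real.log (c n)) (logVar β n)) (s := Set.Ici 0))
    linarith

variable [IsProbabilityMeasure P] [IsProbabilityMeasure Q]

lemma critical_bounds (hH : IsHamiltonian P H) (hJ : IsJumpDynamics Q J e) (hβ : 0 < β)
    (ha : IsAuxScale P H β a c) {ε : ℝ} (hc : IsIntermediateTimeScale ε a c)
    (hα : alpha β ε = 1) :
    ∃ w₁ w₂ : ℕ → ℝ, Tendsto w₁ atTop (𝓝 0) ∧ Tendsto w₂ atTop (𝓝 0) ∧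
      ∀ T : ℝ, 0 < T → ∀ η : ℝ, 0 < η → ∀ r : ℝ, 0 < r →
        (∃ C : ℝ, ∀ᶠ n in atTop, P.real {ω | r ≤ deviationProb Q (fun t ξ =>
          M H J β a c n ω t ξ / meanM P Q H J β a c n) T η} ≤
            C * (a n / 2 ^ n * w₁ n + n ^ 2 / 2 ^ n)) ∧
        (∃ C : ℝ, ∀ᶠ n in atTop, P.real {ω | r ≤ deviationProb Q (fun t ξ =>
          S H J e β a c n ω t ξ / meanM P Q H J β a c n) T η} ≤
            C * (a n / 2 ^ n * w₂ n + n ^ 2 / 2 ^ n)) := by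
  let v : ℕ → NNReal := logVar β
  let κ : ℕ → ℝ := fun n => Real.log (c n) / v n
  have hv0 : ∀ᶠ n in atTop, v n ≠ 0 := by
    filter_upwards [eventually_ge_atTop 1] with n hn
    exact logVar_ne_zero hβ hn
  have hv := tendsto_logVar hβ
  have hκv : ∀ᶠ n in atTop, Real.log (c n) = κ n * v n := by
    filter_upwards [hv0] with n hn
    have : (v n : ℝ) ≠ 0 := by exact_mod_cast hn
    simp only [κ]
    field_simp
  have hc0 := hc.diverges.eventually_gt_atTop 0
  have hκ0 : ∀ᶠ n in atTop, 0 ≤ κ n := by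
    filter_upwards [hc.diverges.eventually_ge_atTop 1] with n hn
    exact div_nonneg (Real.log_nonneg hn) (v n).coe_nonneg
  have hapos := eventually_aux_pos hH ha hc.diverges
  have hai := hc.tendsto_atTop hapos
  have htail : ∀ᶠ n in atTop,
      a n * (gaussianReal (-(κ n * v n)) (v n)).real (Set.Ici 0) = 1 := by
    filter_upwards [eventually_mul_tail hH ha hc.diverges, hκv] with n h1 h2
    rwa [h2] at h1
  have hκ : Tendsto κ atTop (𝓝 1) := by
    have hl : Tendsto (fun n => 2 * Real.log (a n) / (v n : ℝ)) atTop (𝓝 1) := by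
      have h1 := hc.log_limit.mul_const (2 * Real.log 2 / β ^ 2)
      have h2 : ε * (2 * Real.log 2 / β ^ 2) = 1 := by
        rw [alpha, betaC, div_eq_one_iff_eq hβ.ne', Real.sqrt_eq_iff_mul_self_eq_of_pos hβ] at hα
        rw [mul_div_assoc', div_eq_one_iff_eq (by positivity), ← hα, sq]
      rw [h2] at h1
      refine h1.congr' ?_
      filter_upwards [eventually_ge_atTop 1] with n hn
      have h3 : (n : ℝ) ≠ 0 := by positivity
      have h4 := (Real.log_pos one_lt_two).ne'
      simp only [v, coe_logVar]
      field_simp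
    have h1 := (tendsto_sq_exponent hv0 hv hκ0 htail hl).sqrt
    rw [Real.sqrt_one] at h1
    refine h1.congr' ?_
    filter_upwards [hκ0] with n hn
    exact Real.sqrt_sq hn
  obtain ⟨l1, l2, l3, l4⟩ := critical_scale_limits hv0 hv hκ htail hai
  have l0 := tendsto_mul_cutMeanOne hv0 hv hκ htail
  have hD : ∀ᶠ n in atTop, 0 < ⌊a n⌋₊ * cutMeanOne (κ n) (v n) := by
    filter_upwards [hai.eventually_ge_atTop 1, l0.eventually_gt_atTop 0] with n h1 h2
    exact mul_pos (by exact_mod_cast Nat.floor_pos.2 h1) (pos_of_mul_pos_right h2 (by linarith))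
  have hmean : ∀ᶠ n in atTop, meanM P Q H J β a c n = ⌊a n⌋₊ * cutMeanOne (κ n) (v n) := by
    filter_upwards [hκv, hc0, eventually_ge_atTop 1] with n h1 h2 h3
    rw [meanM_eq hH hJ h3 h2, h1, cutMeanOne]
  have l0' : Tendsto (fun n => 1 / (a n * cutMeanOne (κ n) (v n))) atTop (𝓝 0) :=
    tendsto_const_nhds.div_atTop l0
  have hX : ∀ n, 1 ≤ n → IsTimedWalk Q (J n) (e n) := fun n hn => hJ.isTimedWalk hn
  refine ⟨_, _, l0', by simpa using l3.add l4, fun T hT η hη r hr => ⟨?_, ?_⟩⟩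
  · obtain ⟨C, hC⟩ := exists_centering_deviation_bound (P := P) (A := fun _ => 1)
      (h := fun n x ω => cutMean 1 (Real.exp (-β * H n x ω + -(κ n * v n))))
      (fun n hn => (hX n hn).walk) (by
        filter_upwards [eventually_ge_atTop 1] with n hn
        exact hH.isBoundedField hn _ (measurable_cutMean_exp 1)
          (fun y => cutMean_nonneg zero_le_one (Real.exp_pos y))
          (fun y => cutMean_le zero_le_one (Real.exp_pos y))) hai hD l1 l0' hT hη hr
    refine ⟨C, ?_⟩
    filter_upwards [hC, hκv, hc0, hmean] with n hn h1 h2 h3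
    simp_rw [M_eq_sum h2, h3, h1]
    exact hn
  · obtain ⟨C, hC⟩ := exists_clock_deviation_bound (P := P)
      (z := fun n x ω => Real.exp (-β * H n x ω + -(κ n * v n))) hX
      (Eventually.of_forall fun n x ω => Real.exp_pos _) (by
        filter_upwards [eventually_ge_atTop 1] with n hn
        exact hH.isBoundedField hn _ (measurable_cutMean_exp _)
          (fun y => cutMean_nonneg (sq_nonneg _) (Real.exp_pos y))
          (fun y => cutMean_le (sq_nonneg _) (Real.exp_pos y))) (by
        filter_upwards [eventually_ge_atTop 1] with n hn
        exact hH.isBoundedField hn _ (measurable_overshoot_exp _)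
          (fun y => overshoot_nonneg _ _)
          (fun y => overshoot_le_one (sq_nonneg _) (Real.exp_pos y))) hai hD l2 l3 l4 hT hη hr
    refine ⟨C, ?_⟩
    filter_upwards [hC, hκv, hc0, hmean] with n hn h1 h2 h3
    simp_rw [S_eq_sum h2, h3, h1]
    exact hn

lemma subcritical_bounds (hH : IsHamiltonian P H) (hJ : IsJumpDynamics Q J e) (hβ : 0 < β)
    (ha : IsAuxScale P H β a c) {ε : ℝ} (hc : IsIntermediateTimeScale ε a c)
    (hα : 1 < alpha β ε) :
    ∃ b : ℕ → ℝ, Summable b ∧ ∀ T : ℝ, 0 < T → ∀ η : ℝ, 0 < η → ∀ r : ℝ, 0 < r →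
      ∃ C : ℝ, ∀ᶠ n in atTop, P.real {ω | r ≤ deviationProb Q (fun t ξ =>
        S H J e β a c n ω t ξ / (a n * Real.exp (n * β ^ 2 / 2) / c n)) T η} ≤ C * b n := by
  have hapos := eventually_aux_pos hH ha hc.diverges
  have hai := hc.tendsto_atTop hapos
  have hrate : Tendsto (fun n : ℕ => Real.log (a n) / n) atTop (𝓝 (ε * Real.log 2)) := by
    refine (hc.log_limit.mul_const (Real.log 2)).congr fun n => ?_
    have := (Real.log_pos one_lt_two).ne'
    rw [← div_div, div_mul_cancel₀ _ this]
  have hr : β ^ 2 / 2 < ε * Real.log 2 := by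
    rw [alpha, betaC, one_lt_div hβ, Real.lt_sqrt hβ.le] at hα
    linarith
  obtain ⟨w, d, hd, hwd⟩ := exists_truncation_rate hβ hr hapos hrate
  let v : ℕ → NNReal := logVar β
  let m : ℕ → ℝ := fun n => ∫ y, cutMean (Real.exp (n * w)) (Real.exp y)
    ∂(gaussianReal (-(v n / 2)) (v n))
  let q : ℕ → ℝ := fun n => ∫ y, overshoot (Real.exp (n * w)) (Real.exp y)
    ∂(gaussianReal (-(v n / 2)) (v n))
  have hsum : Summable fun n : ℕ => Real.exp (-(d * n)) := by
    refine (Real.summable_exp_nat_mul_iff.2 (neg_lt_zero.2 hd)).congr fun n => ?_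
    ring_nf
  have hexp := hsum.tendsto_atTop_zero
  have hm1 : ∀ n, m n ≤ 1 := by
    intro n
    have := integral_cutMean_exp_le (b := -(v n / 2)) (v := v n) (Real.exp_pos (n * w)).le
    rwa [neg_add_cancel, Real.exp_zero] at this
  have hm : Tendsto m atTop (𝓝 1) := by
    refine tendsto_of_tendsto_of_tendsto_of_le_of_le' (by simpa using hexp.const_sub 1)
      tendsto_const_nhds ?_ (Eventually.of_forall hm1)
    filter_upwards [hwd] with n hn
    exact hn.2.1
  have hq0 : ∀ n, 0 ≤ q n := fun n => integral_nonneg fun y => overshoot_nonneg _ _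
  have hA : ∀ᶠ n : ℕ in atTop, 0 ≤ Real.exp (n * w) / (a n * m n) ∧
      Real.exp (n * w) / (a n * m n) ≤ 2 * Real.exp (-(d * n)) := by
    filter_upwards [hwd, hapos, hm.eventually (le_mem_nhds (by norm_num : (1 / 2 : ℝ) < 1))]
      with n hn ha0 hm
    refine ⟨by positivity, ?_⟩
    rw [← div_div, div_le_iff₀ (by linarith)]
    refine hn.1.trans ?_
    nlinarith [Real.exp_pos (-(d * n))]
  have h1 : Tendsto (fun n => a n * m n / a n) atTop (𝓝 1) := by
    refine hm.congr' ?_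
    filter_upwards [hapos] with n hn
    field_simp
  have h2 : Tendsto (fun n : ℕ => Real.exp (n * w) / (a n * m n)) atTop (𝓝 0) :=
    squeeze_zero' (hA.mono fun n hn => hn.1) (hA.mono fun n hn => hn.2)
      (by simpa using hexp.const_mul 2)
  have h3 : Tendsto (fun n => a n * q n) atTop (𝓝 0) :=
    squeeze_zero' (hapos.mono fun n hn => mul_nonneg hn.le (hq0 n))
      (hwd.mono fun n hn => hn.2.2) hexp
  refine ⟨fun n => a n / 2 ^ n * (Real.exp (n * w) / (a n * m n) + a n * q n) + n ^ 2 / 2 ^ n,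
    ?_, fun T hT η hη r hr => ?_⟩
  · refine Summable.add ?_ summable_sq_div_two_pow
    refine Summable.of_norm_bounded_eventually_nat (hsum.mul_left 3) ?_
    filter_upwards [hwd, hA, hapos, hc.ratio_limit.eventually (ge_mem_nhds one_pos)]
      with n hn hA ha0 hr
    have hnn : 0 ≤ Real.exp (n * w) / (a n * m n) + a n * q n :=
      add_nonneg hA.1 (mul_nonneg ha0.le (hq0 n))
    rw [Real.norm_eq_abs, abs_of_nonneg (mul_nonneg (by positivity) hnn)]
    refine (mul_le_of_le_one_left hnn hr).trans ?_
    linarith [hA.2, hn.2.2]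
  · obtain ⟨C, hC⟩ := exists_clock_deviation_bound (P := P)
      (z := fun n x ω => Real.exp (-β * H n x ω + -(v n / 2)))
      (fun n hn => hJ.isTimedWalk hn)
      (Eventually.of_forall fun n x ω => Real.exp_pos _) (by
        filter_upwards [eventually_ge_atTop 1] with n hn
        exact hH.isBoundedField hn _ (measurable_cutMean_exp _)
          (fun y => cutMean_nonneg (Real.exp_pos _).le (Real.exp_pos y))
          (fun y => cutMean_le (Real.exp_pos _).le (Real.exp_pos y))) (by
        filter_upwards [eventually_ge_atTop 1] with n hn
        exact hH.isBoundedField hn _ (measurable_overshoot_exp _)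
          (fun y => overshoot_nonneg _ _)
          (fun y => overshoot_le_one (Real.exp_pos _).le (Real.exp_pos y)))
      hai hapos h1 h2 h3 hT hη hr
    refine ⟨C, ?_⟩
    filter_upwards [hC, hapos, hc.diverges.eventually_gt_atTop 0] with n hn ha0 hc0
    have e1 : ∀ ω t ξ, S H J e β a c n ω t ξ / (a n * Real.exp (n * β ^ 2 / 2) / c n) =
        (∑ i ∈ Finset.range (⌊a n * t⌋₊ + 1),
          Real.exp (-β * H n (J n i ξ) ω + -(v n / 2)) * e n i ξ) / a n := by
      intro ω t ξ
      rw [S, clock, Finset.mul_sum, Finset.sum_div, Finset.sum_div]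
      refine Finset.sum_congr rfl fun i _ => ?_
      simp only [landscape, boltzmann, v, coe_logVar]
      rw [Real.exp_add, Real.exp_neg (β ^ 2 * (n : ℝ) / 2), mul_comm (β ^ 2) (n : ℝ)]
      field_simp
    simp_rw [e1]
    exact hn

end Assembly

end REM

theorem proposition1p8
    {Ω : Type*} [MeasurableSpace Ω] (P : Measure Ω) [IsProbabilityMeasure P]
    {Ξ : Type*} [MeasurableSpace Ξ] (Q : Measure Ξ) [IsProbabilityMeasure Q]
    (H : (n : ℕ) → REM.Cube n → Ω → ℝ) (hH : REM.IsHamiltonian P H)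
    (J : (n : ℕ) → ℕ → Ξ → REM.Cube n) (e : ℕ → ℕ → Ξ → ℝ) (hJ : REM.IsJumpDynamics Q J e)
    (β : ℝ) (hβ : 0 < β)
    (a c : ℕ → ℝ) (ha : REM.IsAuxScale P H β a c)
    (ε : ℝ) (hc : REM.IsIntermediateTimeScale ε a c) :
    (REM.alpha β ε = 1 → ∀ T : ℝ, 0 < T → ∀ η : ℝ, 0 < η →
      (Summable (fun n : ℕ => a n / 2 ^ n) →
        (∀ᵐ ω ∂P, Tendsto (fun n => REM.deviationProb Q (fun t ξ =>
          REM.M H J β a c n ω t ξ / REM.meanM P Q H J β a c n) T η) atTop (𝓝 0)) ∧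
        (∀ᵐ ω ∂P, Tendsto (fun n => REM.deviationProb Q (fun t ξ =>
          REM.S H J e β a c n ω t ξ / REM.meanM P Q H J β a c n) T η) atTop (𝓝 0))) ∧
      (¬ Summable (fun n : ℕ => a n / 2 ^ n) →
        TendstoInMeasure P (fun n ω => REM.deviationProb Q (fun t ξ =>
          REM.M H J β a c n ω t ξ / REM.meanM P Q H J β a c n) T η) atTop (fun _ => 0) ∧
        TendstoInMeasure P (fun n ω => REM.deviationProb Q (fun t ξ =>
          REM.S H J e β a c n ω t ξ / REM.meanM P Q H J β a c n) T η) atTop (fun _ => 0))) ∧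
    (1 < REM.alpha β ε → ∀ T : ℝ, 0 < T → ∀ η : ℝ, 0 < η →
      ∀ᵐ ω ∂P, Tendsto (fun n => REM.deviationProb Q (fun t ξ =>
        REM.S H J e β a c n ω t ξ / (a n * Real.exp (n * β ^ 2 / 2) / c n)) T η)
        atTop (𝓝 0)) := by
  refine ⟨fun hα T hT η hη => ?_, fun hα T hT η hη => ?_⟩
  · obtain ⟨w₁, w₂, h1, h2, hb⟩ := REM.critical_bounds hH hJ hβ ha hc hα
    refine ⟨fun hs => ⟨?_, ?_⟩, fun _ => ⟨?_, ?_⟩⟩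
    · exact REM.ae_tendsto_zero_of_summable (fun n ω => REM.deviationProb_nonneg _ _ _)
        (REM.summable_error hs h1) fun r hr => (hb T hT η hη r hr).1
    · exact REM.ae_tendsto_zero_of_summable (fun n ω => REM.deviationProb_nonneg _ _ _)
        (REM.summable_error hs h2) fun r hr => (hb T hT η hη r hr).2
    · exact REM.tendstoInMeasure_zero_of_tendsto (fun n ω => REM.deviationProb_nonneg _ _ _)
        (REM.tendsto_error hc.ratio_limit h1) fun r hr => (hb T hT η hη r hr).1
    · exact REM.tendstoInMeasure_zero_of_tendsto (fun n ω => REM.deviationProb_nonneg _ _ _)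
        (REM.tendsto_error hc.ratio_limit h2) fun r hr => (hb T hT η hη r hr).2
  · obtain ⟨b, hs, hb⟩ := REM.subcritical_bounds hH hJ hβ ha hc hα
    exact REM.ae_tendsto_zero_of_summable (fun n ω => REM.deviationProb_nonneg _ _ _) hs
      fun r hr => hb T hT η hη r hr
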